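/- Let $m,n,k$ be integers with $m\ge 0$ and $1\le k\le n$. An $(m,n,k)$-Magog trapezoid is an array of positive integers $a_{i,j}$, indexed by the pairs $(i,j)$ with $1\le i\le n$, $1\le j\le k$ and $i+j-1\le n$, such that $a_{i,j}\le m+i$ for all $(i,j)$, and $a_{i,j+1}\le a_{i,j}$ and $a_{i,j}\le a_{i+1,j}$ whenever both entries exist. (The entry $a_{i,j}$ stands in row $i+j-1$ of the array, in the $i$-th NE-diagonal counted from the left and in the $j$-th SE-diagonal counted from the right; there are $n$ rows and $k$ SE-diagonals.) A maximum is an entry of the rightmost SE-diagonal $j=1$ with $a_{i,1}=m+i$; a minimum is an entry equal to $1$ of the leftmost SE-diagonal $j=k$. Let $P,Q$ be indeterminates (or arbitrary elements of a commutative ring). Then the generating function $$\sum_{a} P^{\#\text{maxima of }a}\,Q^{\#\text{minima of }a},$$ where $a$ runs over all $(m,n,k)$-Magog trapezoids, is equal to the constant term in $x_1,\ldots,x_n$ of $$\begin{aligned} &(-1)^{(m-1)n+\binom{n+1}{2}}\left((-1)^k Q\,(1+x_{n-k+1}^{-1})\prod_{j=n-k+2}^{n}(x_j^{-1}-x_{n-k+1})+1\right)\\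 &\times\prod_{i=1}^{n-k}(1+x_i)^{-i-k}x_i^{-m-2n+i+1}\bigl(x_i-P(1+x_i)\bigr)\bigl(x_i-Q(1+x_i)\bigr)\\ &\times\prod_{i=n-k+1}^{n}(1+x_i)^{-n-1}x_i^{-m-2n+i+2}\bigl(x_i-P(1+x_i)\bigr)\\ &\times\prod_{1\le i<j\le n}(x_i-x_j)(x_i+x_j+x_ix_j)\prod_{n-k+1\le i<j\le n}\frac{1}{1-x_ix_j}, \end{aligned}$$ where the negative powers of $1+x_i$ and the factors $\frac{1}{1-x_ix_j}$ are expanded in nonnegative powers of the variables, so that the expression is a formal Laurent series in $x_1,\ldots,x_n$. -/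

import Mathlib

namespace Magog

/-- The positions of an `(m, n, k)`-Magog trapezoid (they do not depend on `m`). A position is
given by the index `i` of its NE-diagonal, counted from the left, and the index `j` of its
SE-diagonal, counted from the right, both zero-based. The position `(i, j)` lies in row `i + j`
(zero-based, counted from the top), so the `n` rows give the constraint `i + j < n`. -/
abbrev Cell (n k : ℕ) : Type := {c : Fin n × Fin k // (c.1 : ℕ) + (c.2 : ℕ) < n}

/-- The index, counted from the left starting at `1`, of the NE-diagonal of a position. -/
def Cell.ne {n k : ℕ} (c : Cell n k) : ℕ := (c.1.1 : ℕ) + 1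

/-- The index, counted from the right starting at `1`, of the SE-diagonal of a position. -/
def Cell.se {n k : ℕ} (c : Cell n k) : ℕ := (c.1.2 : ℕ) + 1

/-- `(m, n, k)`-Magog trapezoids: arrays of positive integers, with entries of the `i`-th
NE-diagonal bounded by `m + i`, weakly increasing along NE-diagonals (read upwards to the right,
that is towards the rightmost SE-diagonal) and along SE-diagonals (read downwards to the right). -/
structure IsTrapezoid (m n k : ℕ) (a : Cell n k → ℕ) : Prop where
  pos : ∀ c, 1 ≤ a c
  le_bound : ∀ c, a c ≤ m + c.ne
  mono_ne : ∀ c d : Cell n k, c.ne = d.ne → c.se = d.se + 1 → a c ≤ a d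
  mono_se : ∀ c d : Cell n k, c.se = d.se → d.ne = c.ne + 1 → a c ≤ a d

theorem finite_isTrapezoid (m n k : ℕ) : {a : Cell n k → ℕ | IsTrapezoid m n k a}.Finite :=
  (Set.Finite.pi' fun c : Cell n k => Set.finite_Iic (m + c.ne)).subset
    fun _ ha c => ha.le_bound c

/-- The finite set of all `(m, n, k)`-Magog trapezoids. -/
noncomputable def trapezoids (m n k : ℕ) : Finset (Cell n k → ℕ) :=
  (finite_isTrapezoid m n k).toFinset

/-- The number of maxima: entries in the rightmost SE-diagonal that are equal to the upper bound
for the entries in their NE-diagonal. -/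
def numMaxima (m : ℕ) {n k : ℕ} (a : Cell n k → ℕ) : ℕ :=
  (Finset.univ.filter fun c : Cell n k => c.se = 1 ∧ a c = m + c.ne).card

/-- The number of minima: entries equal to `1` in the leftmost SE-diagonal. -/
def numMinima {n k : ℕ} (a : Cell n k → ℕ) : ℕ :=
  (Finset.univ.filter fun c : Cell n k => c.se = k ∧ a c = 1).card

/-- The generating function of `(m, n, k)`-Magog trapezoids with respect to the weight
`P ^ #maxima * Q ^ #minima`. -/
noncomputable def genFun {R : Type*} [CommRing R] (m n k : ℕ) (P Q : R) : R :=
  ∑ a ∈ trapezoids m n k, P ^ numMaxima m a * Q ^ numMinima a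

/-- Formal Laurent series in `n` variables over `R`. The order on exponent vectors `Fin n → ℤ` is
the componentwise one, for which a set is partially well-ordered exactly if it is bounded below;
so these are the series `R⟦x₁, …, xₙ⟧[x₁⁻¹, …, xₙ⁻¹]` in which rational functions are expanded in
powers with nonnegative exponents. -/
abbrev Laurent (n : ℕ) (R : Type*) [CommRing R] : Type _ := HahnSeries (Fin n → ℤ) R

variable {n : ℕ} {R : Type*} [CommRing R]

/-- The constant term of a formal Laurent series. -/
def constTerm (f : Laurent n R) : R := f.coeff 0

/-- The variable `x_i`, as a unit of the ring of Laurent series. The variables are indexed by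
`Fin n`, so `x i` is the variable `x_{i+1}` in one-based numbering. -/
noncomputable def x (R : Type*) [CommRing R] (i : Fin n) : (Laurent n R)ˣ where
  val := HahnSeries.single (Pi.single i (1 : ℤ)) (1 : R)
  inv := HahnSeries.single (Pi.single i (-1 : ℤ)) (1 : R)
  val_inv := by
    rw [HahnSeries.single_mul_single, ← Pi.single_add]; simp
  inv_val := by
    rw [HahnSeries.single_mul_single, ← Pi.single_add]; simp

/-- The inclusion of natural exponent vectors in integer ones. -/
def natExp (n : ℕ) : (Fin n →₀ ℕ) →+ (Fin n → ℤ) where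
  toFun e i := (e i : ℤ)
  map_zero' := by ext; simp
  map_add' _ _ := by ext; simp

/-- The inclusion of formal power series in formal Laurent series. -/
noncomputable def ofPowerSeries (n : ℕ) (R : Type*) [CommRing R] :
    MvPowerSeries (Fin n) R →+* Laurent n R :=
  (HahnSeries.embDomainRingHom (natExp n)
      (fun e f h => by ext i; simpa [natExp] using congrFun h i)
      (fun e f => by simp [natExp, Pi.le_def, Finsupp.le_def])).comp
    (HahnSeries.toMvPowerSeries (R := R) (σ := Fin n)).symm.toRingHom

theorem ofPowerSeries_X (i : Fin n) :
    ofPowerSeries n R (MvPowerSeries.X i) = (x R i : Laurent n R) := by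
  have h : (HahnSeries.toMvPowerSeries (R := R) (σ := Fin n)).symm (MvPowerSeries.X i) =
      HahnSeries.single (Finsupp.single i 1) 1 := by
    classical
    ext e
    rw [HahnSeries.coeff_toMvPowerSeries_symm, MvPowerSeries.coeff_X, HahnSeries.coeff_single]
    congr
  simp only [ofPowerSeries, RingHom.comp_apply, RingEquiv.toRingHom_eq_coe, RingHom.coe_coe, h]
  refine HahnSeries.embDomain_single.trans ?_
  simp only [x]
  congr 2
  funext j
  simp [natExp, Finsupp.single_apply, Pi.single_apply, eq_comm]

theorem isUnit_one_add_x (i : Fin n) : IsUnit (1 + (x R i : Laurent n R)) := by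
  have h : IsUnit (1 + MvPowerSeries.X i : MvPowerSeries (Fin n) R) := by
    rw [MvPowerSeries.isUnit_iff_constantCoeff]; simp
  simpa [ofPowerSeries_X] using h.map (ofPowerSeries n R)

theorem isUnit_one_sub_x_mul_x (i j : Fin n) :
    IsUnit (1 - (x R i : Laurent n R) * (x R j : Laurent n R)) := by
  have h : IsUnit (1 - MvPowerSeries.X i * MvPowerSeries.X j : MvPowerSeries (Fin n) R) := by
    rw [MvPowerSeries.isUnit_iff_constantCoeff]; simp
  simpa [ofPowerSeries_X] using h.map (ofPowerSeries n R)

/-- `1 + x_i`, as a unit of the ring of Laurent series. -/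
noncomputable def onePlusX (R : Type*) [CommRing R] (i : Fin n) : (Laurent n R)ˣ :=
  (isUnit_one_add_x (R := R) i).unit

/-- `1 - x_i x_j`, as a unit of the ring of Laurent series. -/
noncomputable def oneSubXX (R : Type*) [CommRing R] (i j : Fin n) : (Laurent n R)ˣ :=
  (isUnit_one_sub_x_mul_x (R := R) i j).unit

/-- The one-based index of a variable. -/
def idx (i : Fin n) : ℤ := ((i : ℕ) : ℤ) + 1

/-- The last correction factor, with `s = x_{n-k+1}`:
`(-1)^k Q (1 + x_{n-k+1}⁻¹) ∏_{j=n-k+2}^n (x_j⁻¹ - x_{n-k+1}) + 1`. -/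
noncomputable def correction (k : ℕ) (hk : 1 ≤ k) (hkn : k ≤ n) (Q : R) : Laurent n R :=
  let s : Fin n := ⟨n - k, by omega⟩
  ((-1) ^ k * HahnSeries.C Q * (1 + (((x R s)⁻¹ : (Laurent n R)ˣ) : Laurent n R)) *
      ∏ j ∈ Finset.univ.filter (fun j : Fin n => (n : ℤ) - k + 2 ≤ idx j),
        ((((x R j)⁻¹ : (Laurent n R)ˣ) : Laurent n R) - (x R s : Laurent n R)))
    + 1

/-- The Laurent series whose constant term is the generating function of Magog trapezoids. -/
noncomputable def expression (m n k : ℕ) (hk : 1 ≤ k) (hkn : k ≤ n) (P Q : R) : Laurent n R :=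
  (((-1 : (Laurent n R)ˣ) ^ (((m : ℤ) - 1) * n + ((n + 1).choose 2 : ℕ)) : (Laurent n R)ˣ) :
      Laurent n R) *
  correction k hk hkn Q *
  (∏ i ∈ Finset.univ.filter (fun i : Fin n => idx i ≤ (n : ℤ) - k),
    ((onePlusX R i ^ (-idx i - k) : (Laurent n R)ˣ) : Laurent n R) *
    ((x R i ^ (-(m : ℤ) - 2 * n + idx i + 1) : (Laurent n R)ˣ) : Laurent n R) *
    ((x R i : Laurent n R) - HahnSeries.C P * (1 + (x R i : Laurent n R))) *
    ((x R i : Laurent n R) - HahnSeries.C Q * (1 + (x R i : Laurent n R)))) *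
  (∏ i ∈ Finset.univ.filter (fun i : Fin n => (n : ℤ) - k + 1 ≤ idx i),
    ((onePlusX R i ^ (-(n : ℤ) - 1) : (Laurent n R)ˣ) : Laurent n R) *
    ((x R i ^ (-(m : ℤ) - 2 * n + idx i + 2) : (Laurent n R)ˣ) : Laurent n R) *
    ((x R i : Laurent n R) - HahnSeries.C P * (1 + (x R i : Laurent n R)))) *
  (∏ i : Fin n, ∏ j ∈ Finset.Ioi i,
    ((x R i : Laurent n R) - (x R j : Laurent n R)) *
    ((x R i : Laurent n R) + (x R j : Laurent n R) + (x R i : Laurent n R) * (x R j : Laurent n R))) *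
  (∏ i ∈ Finset.univ.filter (fun i : Fin n => (n : ℤ) - k + 1 ≤ idx i), ∏ j ∈ Finset.Ioi i,
    (((oneSubXX R i j)⁻¹ : (Laurent n R)ˣ) : Laurent n R))

end Magog

namespace Magog

variable {n : ℕ} {R : Type*} [CommRing R]

/-! ### Constant terms, orders, substitutions and permutations of variables -/

/-! Put `y = -x`, number rows (NE-diagonals) from zero, and call the SE-diagonals columns. The proof
runs through one functional, `altFun`, which sends `f` to the constant term of `∏ b(y_i) ∏_{i<j}
(v(y_j) - v(y_i)) f`. It is alternating in the variables, and on products `∏ g_i(y_i)` it is a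
determinant, the alternating multilinear form `altForm`.

With `b = y^(-m-1) (1-y)^(-1) (y + P(1-y))` and `v = (1-y)/y²`, evaluate the form at `g_i =
y^(a_i+i) (1-y)^(-i)` for a weakly increasing first column `a`. If `a` respects the upper bounds,
the matrix is triangular with diagonal entries `P` (maximum) or `1`; otherwise the determinant is
zero. So `altForm_firstCol` encodes both the bounds and the maxima.

Summing over a column with its successor held fixed telescopes row by row. The boundary term in each
row is proportional to the entry of the next row, so alternation kills it (`sum_between`). The net
effect of a new column is one more factor `(1-y_i)^(-1)` in every row that the column meets
(`sum_trapezoids_eq`). Summing out the last column in the rows `i < n-k` works the same way and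
turns the weight of the minima into factors `y + Q(1-y)` (`lastCol_weight`).

What remains is a sum over weakly increasing entries of the last `k` rows, where all powers of `1-y`
agree. This is a Littlewood-type sum: under an alternating functional, the sum of `y^(δ+h)` over
weakly increasing heights `h` becomes `y^δ ∏ (1-y_i)^(-1) ∏_{i<j} (1-y_i y_j)^(-1)`
(`sum_heights_eq`). It is proved by separating smallest height zero from smallest height positive,
and the key cancellation is `AltOn.pivot_eq`. Weighting a zero smallest height by `Q` gives the
correction factor (`sum_heights_weighted`). Finally `expression_eq` identifies the result with the
given Laurent series. -/

/-- The constant term as a linear functional. -/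
def constTermLin (n : ℕ) (R : Type*) [CommRing R] : Laurent n R →ₗ[R] R where
  toFun := constTerm
  map_add' _ _ := rfl
  map_smul' _ _ := rfl

/-- All exponents of `f` are at least `N` in the coordinate `i`. -/
def OrdGE (i : Fin n) (N : ℤ) (f : Laurent n R) : Prop := ∀ e, f.coeff e ≠ 0 → N ≤ e i

theorem OrdGE.mul {i : Fin n} {N N' : ℤ} {f g : Laurent n R} (hf : OrdGE i N f)
    (hg : OrdGE i N' g) : OrdGE i (N + N') (f * g) := by
  intro e he
  obtain ⟨a, ha, b, hb, rfl⟩ := HahnSeries.support_mul_subset ((HahnSeries.mem_support _ _).2 he)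
  exact add_le_add (hf a ha) (hg b hb)

theorem OrdGE.constTerm_eq_zero {i : Fin n} {N : ℤ} {f : Laurent n R} (hf : OrdGE i N f)
    (hN : 0 < N) : constTerm f = 0 := by
  by_contra h
  exact absurd (hf 0 h) (by simpa using hN)

theorem OrdGE.mono {i : Fin n} {N N' : ℤ} {f : Laurent n R} (hf : OrdGE i N f) (h : N' ≤ N) :
    OrdGE i N' f := fun e he => h.trans (hf e he)

/-- Coordinate projections of the support are well-ordered subsets of `ℤ`, hence bounded below. The
uniform bound later allows the infinite sum over heights to be truncated. -/
theorem exists_ordGE (f : Laurent n R) : ∃ N : ℤ, ∀ i, OrdGE i N f := by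
  have h : ∀ i : Fin n, ∃ N : ℤ, OrdGE i N f := by
    intro i
    have h1 : (Function.eval i '' f.support).IsPWO :=
      f.isPWO_support.image_of_monotone (fun a b hab => hab i)
    obtain hemp | hne := (Function.eval i '' f.support).eq_empty_or_nonempty
    · refine ⟨0, fun e he => ?_⟩
      have : e i ∈ (Function.eval i '' f.support) := ⟨e, he, rfl⟩
      simp [hemp] at this
    · exact ⟨h1.isWF.min hne, fun e he => h1.isWF.min_le hne ⟨e, he, rfl⟩⟩
  choose N hN using h
  obtain ⟨M, hM⟩ := (Set.finite_range N).bddBelow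
  exact ⟨M, fun i => (hN i).mono (hM ⟨i, rfl⟩)⟩

/-- Permutation of the variables. -/
def permExp (π : Equiv.Perm (Fin n)) : (Fin n → ℤ) →+ (Fin n → ℤ) where
  toFun e := e ∘ π.symm
  map_zero' := rfl
  map_add' _ _ := rfl

/-- The ring endomorphism of the Laurent series that permutes the variables. -/
noncomputable def act (π : Equiv.Perm (Fin n)) : Laurent n R →+* Laurent n R :=
  HahnSeries.embDomainRingHom (permExp π)
    (fun e f h => by
      funext i
      simpa [permExp] using congrFun h (π i))
    (fun e f => by
      simp only [permExp, AddMonoidHom.coe_mk, ZeroHom.coe_mk, Pi.le_def, Function.comp]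
      exact ⟨fun h i => by simpa using h (π i), fun h i => h _⟩)

theorem coeff_act (π : Equiv.Perm (Fin n)) (f : Laurent n R) (e : Fin n → ℤ) :
    (act π f).coeff e = f.coeff (e ∘ π) := by
  have h : e = permExp π (e ∘ π) := by
    funext i
    simp [permExp]
  conv_lhs => rw [h]
  exact HahnSeries.embDomain_mk_coeff (f := permExp π) _ _

theorem constTerm_act (π : Equiv.Perm (Fin n)) (f : Laurent n R) :
    constTerm (act π f) = constTerm f := by
  simp only [constTerm, coeff_act]
  rfl

/-- Substitution of the `i`-th variable in a one-variable Laurent series. -/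
noncomputable def subst (i : Fin n) : HahnSeries ℤ R →+* Laurent n R :=
  HahnSeries.embDomainRingHom (AddMonoidHom.single (fun _ : Fin n => ℤ) i)
    (fun a b h => by simpa using h)
    (fun a b => by simp)

theorem coeff_subst_single (i : Fin n) (g : HahnSeries ℤ R) (t : ℤ) :
    (subst i g).coeff (Pi.single i t) = g.coeff t :=
  HahnSeries.embDomain_mk_coeff (f := AddMonoidHom.single (fun _ : Fin n => ℤ) i) _ _

theorem exists_of_coeff_subst_ne_zero {i : Fin n} {g : HahnSeries ℤ R} {e : Fin n → ℤ}
    (h : (subst i g).coeff e ≠ 0) : ∃ t, g.coeff t ≠ 0 ∧ e = Pi.single i t := by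
  obtain ⟨t, ht, rfl⟩ := HahnSeries.support_embDomain_subset ((HahnSeries.mem_support _ _).2 h)
  exact ⟨t, ht, rfl⟩

theorem act_subst (π : Equiv.Perm (Fin n)) (i : Fin n) (g : HahnSeries ℤ R) :
    act π (subst i g) = subst (π i) g := by
  have key : ∀ t : ℤ, (Pi.single (π i) t : Fin n → ℤ) ∘ π = Pi.single i t := by
    intro t
    funext j
    simp [Pi.single_apply]
  ext e
  rw [coeff_act]
  by_cases h : ∃ t, e = Pi.single (π i) t
  · obtain ⟨t, rfl⟩ := h
    rw [key, coeff_subst_single, coeff_subst_single]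
  · have h1 : (subst (π i) g).coeff e = 0 := by
      by_contra h'
      obtain ⟨t, -, ht⟩ := exists_of_coeff_subst_ne_zero h'
      exact h ⟨t, ht⟩
    have h2 : (subst i g).coeff (e ∘ π) = 0 := by
      by_contra h'
      obtain ⟨t, -, ht⟩ := exists_of_coeff_subst_ne_zero h'
      refine h ⟨t, ?_⟩
      rw [← key] at ht
      funext j
      simpa using congrFun ht (π.symm j)
    rw [h1, h2]

theorem ordGE_subst_self {i : Fin n} {g : HahnSeries ℤ R} {N : ℤ}
    (hg : ∀ t, g.coeff t ≠ 0 → N ≤ t) : OrdGE i N (subst i g) := by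
  intro e he
  obtain ⟨t, ht, rfl⟩ := exists_of_coeff_subst_ne_zero he
  simpa using hg t ht

theorem constTerm_prod_subst (S : Finset (Fin n)) (g : Fin n → HahnSeries ℤ R) :
    constTerm (∏ i ∈ S, subst i (g i)) = ∏ i ∈ S, (g i).coeff 0 := by
  classical
  -- The induction also needs that the product involves only variables from `S`: then exponents of
  -- the new factor cannot cancel against those of the old ones.
  have main : ∀ S : Finset (Fin n),
      constTerm (∏ i ∈ S, subst i (g i)) = ∏ i ∈ S, (g i).coeff 0 ∧
      ∀ i ∉ S, ∀ e, (∏ i ∈ S, subst i (g i)).coeff e ≠ 0 → e i = 0 := by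
    intro S
    induction S using Finset.induction_on with
    | empty =>
      refine ⟨by simp [constTerm, HahnSeries.coeff_one], fun i _ e he => ?_⟩
      rw [Finset.prod_empty, HahnSeries.coeff_one] at he
      by_contra h
      exact he (if_neg (by rintro rfl; exact h rfl))
    | insert a S ha ih =>
      rw [Finset.prod_insert ha, Finset.prod_insert ha, ← ih.1]
      refine ⟨?_, fun i hi e he => ?_⟩
      · unfold constTerm
        rw [HahnSeries.coeff_mul]
        rw [Finset.sum_eq_single (0, 0)]
        · congr 1
          simpa using coeff_subst_single a (g a) 0
        · rintro ⟨p, q⟩ hpq hne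
          simp only [Finset.mem_antidiagonal, HahnSeries.mem_support] at hpq
          obtain ⟨t, -, rfl⟩ := exists_of_coeff_subst_ne_zero hpq.1
          have h1 := ih.2 a ha q hpq.2.1
          have h2 := congrFun hpq.2.2 a
          simp only [Pi.add_apply, Pi.single_eq_same, h1, Pi.zero_apply, add_zero] at h2
          subst h2
          simp only [Pi.single_zero, zero_add] at hpq hne
          exact absurd (by rw [hpq.2.2]) hne
        · intro h
          simp only [Finset.mem_antidiagonal, HahnSeries.mem_support] at h
          by_contra hc
          exact h ⟨left_ne_zero_of_mul hc, right_ne_zero_of_mul hc, by simp⟩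
      · simp only [Finset.mem_insert, not_or] at hi
        obtain ⟨p, hp, q, hq, rfl⟩ :=
          HahnSeries.support_mul_subset ((HahnSeries.mem_support _ _).2 he)
        obtain ⟨t, -, rfl⟩ := exists_of_coeff_subst_ne_zero hp
        simp [hi.1, ih.2 i hi.2 q hq]
  exact (main S).1

theorem subst_C (i : Fin n) (r : R) : subst i (HahnSeries.C r) = HahnSeries.C r :=
  HahnSeries.embDomainRingHom_C

theorem subst_smul (i : Fin n) (r : R) (g : HahnSeries ℤ R) :
    subst i (r • g) = r • subst i g := by
  rw [← HahnSeries.C_mul_eq_smul, map_mul, subst_C, HahnSeries.C_mul_eq_smul]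

/-! ### Alternating functionals -/

/-- A linear functional that is alternating in the variables with index at least `s`. -/
structure AltOn (s : ℕ) (τ : Laurent n R →ₗ[R] R) : Prop where
  fixed : ∀ i j : Fin n, s ≤ (i : ℕ) → s ≤ (j : ℕ) → i ≠ j →
    ∀ f, act (Equiv.swap i j) f = f → τ f = 0
  swap : ∀ i j : Fin n, s ≤ (i : ℕ) → s ≤ (j : ℕ) → i ≠ j →
    ∀ f, τ (act (Equiv.swap i j) f) = -τ f

theorem AltOn.mono {s t : ℕ} {τ : Laurent n R →ₗ[R] R} (h : AltOn s τ) (hst : s ≤ t) :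
    AltOn t τ where
  fixed i j hi hj := h.fixed i j (hst.trans hi) (hst.trans hj)
  swap i j hi hj := h.swap i j (hst.trans hi) (hst.trans hj)

/-- An element that is symmetric in the variables with index at least `s`. -/
def SymOn (s : ℕ) (g : Laurent n R) : Prop :=
  ∀ i j : Fin n, s ≤ (i : ℕ) → s ≤ (j : ℕ) → i ≠ j → act (Equiv.swap i j) g = g

theorem SymOn.mul {s : ℕ} {f g : Laurent n R} (hf : SymOn s f) (hg : SymOn s g) :
    SymOn s (f * g) := fun i j hi hj hij => by rw [map_mul, hf i j hi hj hij, hg i j hi hj hij]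

theorem SymOn.one {s : ℕ} : SymOn s (1 : Laurent n R) := fun _ _ _ _ _ => map_one _

theorem SymOn.sub {s : ℕ} {f g : Laurent n R} (hf : SymOn s f) (hg : SymOn s g) :
    SymOn s (f - g) := fun i j hi hj hij => by rw [map_sub, hf i j hi hj hij, hg i j hi hj hij]

theorem SymOn.neg {s : ℕ} {f : Laurent n R} (hf : SymOn s f) :
    SymOn s (-f) := fun i j hi hj hij => by rw [map_neg, hf i j hi hj hij]

theorem SymOn.pow {s : ℕ} {f : Laurent n R} (hf : SymOn s f) (k : ℕ) :
    SymOn s (f ^ k) := fun i j hi hj hij => by rw [map_pow, hf i j hi hj hij]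

theorem SymOn.mono {s t : ℕ} {f : Laurent n R} (hf : SymOn s f) (h : s ≤ t) :
    SymOn t f := fun i j hi hj => hf i j (h.trans hi) (h.trans hj)

/-- The functional `f ↦ τ (g * f)`. -/
noncomputable def mulFun (τ : Laurent n R →ₗ[R] R) (g : Laurent n R) : Laurent n R →ₗ[R] R :=
  τ ∘ₗ LinearMap.mulLeft R g

@[simp] theorem mulFun_apply (τ : Laurent n R →ₗ[R] R) (g f : Laurent n R) :
    mulFun τ g f = τ (g * f) := rfl

theorem AltOn.mul_symOn {s : ℕ} {τ : Laurent n R →ₗ[R] R} (h : AltOn s τ) {g : Laurent n R}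
    (hg : SymOn s g) : AltOn s (mulFun τ g) where
  fixed i j hi hj hij f hf := by
    rw [mulFun_apply]
    exact h.fixed i j hi hj hij _ (by rw [map_mul, hg i j hi hj hij, hf])
  swap i j hi hj hij f := by
    have := h.swap i j hi hj hij (g * f)
    rwa [map_mul, hg i j hi hj hij] at this

theorem symOn_subst {s : ℕ} {i : Fin n} (h : (i : ℕ) < s) (g : HahnSeries ℤ R) :
    SymOn s (subst i g) := by
  intro a b ha hb _
  rw [act_subst, Equiv.swap_apply_of_ne_of_ne]
  · rintro rfl; omega
  · rintro rfl; omega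

theorem symOn_prod_subst {s : ℕ} (g : HahnSeries ℤ R) :
    SymOn s (∏ i ∈ Finset.univ.filter (fun i : Fin n => s ≤ (i : ℕ)), subst i g) := by
  intro a b ha hb _
  rw [map_prod]
  refine Finset.prod_nbij' (Equiv.swap a b) (Equiv.swap a b) ?_ ?_ (by simp) (by simp)
    (fun i _ => by rw [act_subst])
  all_goals
    intro i hi
    simp only [Finset.mem_filter, Finset.mem_univ, true_and] at hi ⊢
    rw [Equiv.swap_apply_def]
    split_ifs <;> assumption

/-- The Vandermonde product in the values of `v` at the variables. -/
noncomputable def alternant (n : ℕ) (v : HahnSeries ℤ R) : Laurent n R :=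
  ∏ i : Fin n, ∏ j ∈ Finset.Ioi i, (subst j v - subst i v)

theorem alternant_eq_sum (v : HahnSeries ℤ R) :
    alternant n v = ∑ π : Equiv.Perm (Fin n), (Equiv.Perm.sign π : ℤ) •
      ∏ i, subst (π i) (v ^ (i : ℕ)) := by
  rw [alternant, ← Matrix.det_vandermonde, Matrix.det_apply]
  simp [Matrix.vandermonde, map_pow, Units.smul_def]

/-- The alternating functional `f ↦ CT (∏ b(x_i) ∏_{i<j} (v(x_j) - v(x_i)) f)`. -/
noncomputable def altFun (n : ℕ) (b v : HahnSeries ℤ R) : Laurent n R →ₗ[R] R :=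
  mulFun (constTermLin n R) ((∏ i, subst i b) * alternant n v)

theorem altFun_eq_sum (b v : HahnSeries ℤ R) (f : Laurent n R) :
    altFun n b v f = ∑ π : Equiv.Perm (Fin n), (Equiv.Perm.sign π : ℤ) •
      constTerm ((∏ i, subst (π i) (b * v ^ (i : ℕ))) * f) := by
  have h : (∏ i, subst i b) * alternant n v * f =
      ∑ π : Equiv.Perm (Fin n), (Equiv.Perm.sign π : ℤ) •
        ((∏ i, subst (π i) (b * v ^ (i : ℕ))) * f) := by
    rw [alternant_eq_sum, Finset.mul_sum, Finset.sum_mul]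
    refine Finset.sum_congr rfl fun π _ => ?_
    simp only [map_mul, Finset.prod_mul_distrib]
    rw [← Equiv.prod_comp π (fun i => subst i b), mul_smul_comm, smul_mul_assoc]
  rw [altFun, mulFun_apply, h, map_sum]
  exact Finset.sum_congr rfl fun π _ => map_zsmul (constTermLin n R) _ _

/-- In the sum over permutations, a transposition pairs `π` with `swap * π`, of opposite sign.
Vanishing on fixed elements comes from cancelling these pairs, because antisymmetry alone would only
give `2 τ f = 0`. -/
theorem altOn_altFun (b v : HahnSeries ℤ R) : AltOn 0 (altFun n b v) := by
  have key : ∀ (σ π : Equiv.Perm (Fin n)) (f : Laurent n R),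
      constTerm ((∏ i, subst ((σ * π) i) (b * v ^ (i : ℕ))) * act σ f) =
      constTerm ((∏ i, subst (π i) (b * v ^ (i : ℕ))) * f) := by
    intro σ π f
    rw [← constTerm_act σ ((∏ i, subst (π i) (b * v ^ (i : ℕ))) * f), map_mul, map_prod]
    simp only [act_subst, Equiv.Perm.mul_apply]
  constructor
  · intro i j _ _ hij f hf
    rw [altFun_eq_sum]
    refine Finset.sum_involution (fun π _ => Equiv.swap i j * π) ?_ ?_ (by simp) (by simp)
    · intro π _
      conv_lhs => enter [2, 2, 1, 2]; rw [← hf]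
      rw [key, Equiv.Perm.sign_mul, Equiv.Perm.sign_swap hij]
      simp
    · intro π _ _ h
      rw [mul_eq_right, Equiv.swap_eq_one_iff] at h
      exact hij h
  · intro i j _ _ hij f
    rw [altFun_eq_sum, altFun_eq_sum, ← Finset.sum_neg_distrib,
      ← Equiv.sum_comp (Equiv.mulLeft (Equiv.swap i j))]
    refine Finset.sum_congr rfl fun π _ => ?_
    rw [Equiv.coe_mulLeft, key, Equiv.Perm.sign_mul, Equiv.Perm.sign_swap hij]
    simp

theorem constTerm_prod_subst_perm (π : Equiv.Perm (Fin n)) (h : Fin n → HahnSeries ℤ R) :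
    constTerm (∏ i, subst (π i) (h i)) = ∏ i, (h i).coeff 0 := by
  rw [← Equiv.prod_comp π.symm]
  simp only [Equiv.apply_symm_apply]
  rw [constTerm_prod_subst, Equiv.prod_comp π.symm (fun i => (h i).coeff 0)]

/-- This is the Leibniz expansion of the determinant whose entries are the one-variable constant
terms of `b v^σ g_i`. -/
theorem altFun_prod_subst (b v : HahnSeries ℤ R) (g : Fin n → HahnSeries ℤ R) :
    altFun n b v (∏ i, subst i (g i)) = ∑ π : Equiv.Perm (Fin n), (Equiv.Perm.sign π : ℤ) •
      ∏ i : Fin n, (b * v ^ (i : ℕ) * g (π i)).coeff 0 := by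
  rw [altFun_eq_sum]
  refine Finset.sum_congr rfl fun π _ => ?_
  rw [← Equiv.prod_comp π (fun i => subst i (g i)), ← Finset.prod_mul_distrib]
  simp only [← map_mul]
  rw [constTerm_prod_subst_perm π (fun i => b * v ^ (i : ℕ) * g (π i))]

/-- The alternating multilinear form `g ↦ altFun (∏ g_i(x_i))`. -/
noncomputable def altForm (n : ℕ) (b v : HahnSeries ℤ R) : HahnSeries ℤ R [⋀^Fin n]→ₗ[R] R where
  toFun g := altFun n b v (∏ i, subst i (g i))
  map_update_add' := by
    intro _ g i p q
    simp only [← map_add]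
    congr 1
    rw [← Finset.mul_prod_erase _ _ (Finset.mem_univ i),
      ← Finset.mul_prod_erase _ _ (Finset.mem_univ i),
      ← Finset.mul_prod_erase _ _ (Finset.mem_univ i)]
    simp only [Function.update_self, map_add, add_mul]
    congr 1 <;> congr 1 <;>
    · refine Finset.prod_congr rfl fun j hj => ?_
      rw [Function.update_of_ne (Finset.ne_of_mem_erase hj),
        Function.update_of_ne (Finset.ne_of_mem_erase hj)]
  map_update_smul' := by
    intro _ g i c p
    simp only [← map_smul]
    congr 1
    rw [← Finset.mul_prod_erase _ _ (Finset.mem_univ i),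
      ← Finset.mul_prod_erase _ _ (Finset.mem_univ i)]
    simp only [Function.update_self, subst_smul, smul_mul_assoc]
    congr 2
    refine Finset.prod_congr rfl fun j hj => ?_
    rw [Function.update_of_ne (Finset.ne_of_mem_erase hj),
        Function.update_of_ne (Finset.ne_of_mem_erase hj)]
  map_eq_zero_of_eq' := by
    intro g i j hg hij
    refine (altOn_altFun b v).fixed i j (Nat.zero_le _) (Nat.zero_le _) hij _ ?_
    rw [map_prod]
    simp only [act_subst]
    rw [← Equiv.prod_comp (Equiv.swap i j) (fun k => subst k (g k))]
    refine Finset.prod_congr rfl fun k _ => ?_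
    congr 1
    rw [Equiv.swap_apply_def]
    split_ifs with h1 h2
    · rw [h1, hg]
    · rw [h2, hg]
    · rfl

theorem altForm_apply (b v : HahnSeries ℤ R) (g : Fin n → HahnSeries ℤ R) :
    altForm n b v g = altFun n b v (∏ i, subst i (g i)) := rfl

/-! ### The negated variables and a symmetric series -/

theorem subst_single (i : Fin n) (t : ℤ) (r : R) :
    subst i (HahnSeries.single t r) = HahnSeries.single (Pi.single i t) r :=
  HahnSeries.embDomain_single

/-- The negative of a variable. -/
noncomputable def yv (R : Type*) [CommRing R] (i : Fin n) : Laurent n R := -(x R i : Laurent n R)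

theorem yv_eq_subst (i : Fin n) : yv R i = subst i (-HahnSeries.single (1 : ℤ) (1 : R)) := by
  rw [map_neg, subst_single]; rfl

theorem act_yv (π : Equiv.Perm (Fin n)) (i : Fin n) : act π (yv R i) = yv R (π i) := by
  rw [yv_eq_subst, act_subst, ← yv_eq_subst]

theorem coe_onePlusX (i : Fin n) : (onePlusX R i : Laurent n R) = 1 - yv R i := by
  rw [onePlusX, IsUnit.unit_spec, yv, sub_neg_eq_add]

theorem coe_oneSubXX (i j : Fin n) : (oneSubXX R i j : Laurent n R) = 1 - yv R i * yv R j := by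
  rw [oneSubXX, IsUnit.unit_spec, yv, yv, neg_mul_neg]

theorem act_inv_onePlusX (π : Equiv.Perm (Fin n)) (i : Fin n) :
    act π (((onePlusX R i)⁻¹ : (Laurent n R)ˣ) : Laurent n R) =
      (((onePlusX R (π i))⁻¹ : (Laurent n R)ˣ) : Laurent n R) := by
  have h : Units.map (act π).toMonoidHom (onePlusX R i) = onePlusX R (π i) := by
    ext1
    simp [coe_onePlusX, act_yv]
  rw [← h, ← map_inv]
  rfl

theorem act_inv_oneSubXX (π : Equiv.Perm (Fin n)) (i j : Fin n) :
    act π (((oneSubXX R i j)⁻¹ : (Laurent n R)ˣ) : Laurent n R) =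
      (((oneSubXX R (π i) (π j))⁻¹ : (Laurent n R)ˣ) : Laurent n R) := by
  have h : Units.map (act π).toMonoidHom (oneSubXX R i j) = oneSubXX R (π i) (π j) := by
    ext1
    simp [coe_oneSubXX, act_yv]
  rw [← h, ← map_inv]
  rfl

theorem oneSubXX_comm (i j : Fin n) : oneSubXX R i j = oneSubXX R j i := by
  ext1
  rw [coe_oneSubXX, coe_oneSubXX, mul_comm]

/-! ### Blocks of final indices and monomials supported on them -/

/-- The indices that are at least `s`. -/
def blk (n s : ℕ) : Finset (Fin n) := Finset.univ.filter fun i => s ≤ (i : ℕ)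

@[simp] theorem mem_blk {s : ℕ} {i : Fin n} : i ∈ blk n s ↔ s ≤ (i : ℕ) := by simp [blk]

theorem blk_eq_insert {s : ℕ} (hs : s < n) : blk n s = insert ⟨s, hs⟩ (blk n (s + 1)) := by
  ext i
  simp only [mem_blk, Finset.mem_insert, Fin.ext_iff]
  omega

theorem notMem_blk_succ {s : ℕ} (hs : s < n) : (⟨s, hs⟩ : Fin n) ∉ blk n (s + 1) := by simp

theorem Ioi_eq_blk {s : ℕ} (hs : s < n) : Finset.Ioi (⟨s, hs⟩ : Fin n) = blk n (s + 1) := by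
  ext i
  simp only [mem_blk, Finset.mem_Ioi, Fin.lt_def]
  omega

theorem swap_mem_blk {s : ℕ} {a b i : Fin n} (ha : s ≤ (a : ℕ)) (hb : s ≤ (b : ℕ)) :
    Equiv.swap a b i ∈ blk n s ↔ i ∈ blk n s := by
  rw [Equiv.swap_apply_def]
  split_ifs with h1 h2 <;> simp_all

theorem prod_blk_swap {M : Type*} [CommMonoid M] {s : ℕ} {a b : Fin n} (ha : s ≤ (a : ℕ))
    (hb : s ≤ (b : ℕ)) (G : Fin n → M) :
    ∏ i ∈ blk n s, G (Equiv.swap a b i) = ∏ i ∈ blk n s, G i :=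
  Finset.prod_nbij' (Equiv.swap a b) (Equiv.swap a b)
    (fun i hi => (swap_mem_blk ha hb).2 hi) (fun i hi => (swap_mem_blk ha hb).2 hi)
    (by simp) (by simp) (by simp)

theorem prod_blk_pairs_swap {M : Type*} [CommMonoid M] {s : ℕ} {a b : Fin n} (ha : s ≤ (a : ℕ))
    (hb : s ≤ (b : ℕ)) (G : Fin n → Fin n → M) (hG : ∀ i j, G i j = G j i) :
    ∏ i ∈ blk n s, ∏ j ∈ Finset.Ioi i, G (Equiv.swap a b i) (Equiv.swap a b j) =
      ∏ i ∈ blk n s, ∏ j ∈ Finset.Ioi i, G i j := by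
  -- The transposition acts on unordered pairs; `φ` restores the increasing order, at the cost of
  -- the symmetry of `G`.
  let φ : (_ : Fin n) × Fin n → (_ : Fin n) × Fin n := fun p =>
    if Equiv.swap a b p.1 < Equiv.swap a b p.2 then ⟨Equiv.swap a b p.1, Equiv.swap a b p.2⟩
    else ⟨Equiv.swap a b p.2, Equiv.swap a b p.1⟩
  have hmem : ∀ p ∈ (blk n s).sigma fun i => Finset.Ioi i,
      φ p ∈ (blk n s).sigma fun i => Finset.Ioi i := by
    rintro ⟨i, j⟩ h
    simp only [Finset.mem_sigma, Finset.mem_Ioi] at h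
    have hi := h.1
    have hj : j ∈ blk n s := by
      rw [mem_blk] at hi ⊢
      exact hi.trans h.2.le
    have hne : Equiv.swap a b i ≠ Equiv.swap a b j := (Equiv.swap a b).injective.ne h.2.ne
    simp only [φ]
    split_ifs with hlt
    · simpa only [Finset.mem_sigma, Finset.mem_Ioi, swap_mem_blk ha hb] using ⟨hi, hlt⟩
    · simpa only [Finset.mem_sigma, Finset.mem_Ioi, swap_mem_blk ha hb] using
        ⟨hj, lt_of_le_of_ne (not_lt.1 hlt) hne.symm⟩
  have hinv : ∀ p ∈ (blk n s).sigma fun i => Finset.Ioi i, φ (φ p) = p := by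
    rintro ⟨i, j⟩ h
    simp only [Finset.mem_sigma, Finset.mem_Ioi] at h
    by_cases hlt : Equiv.swap a b i < Equiv.swap a b j
    · simp [φ, hlt, h.2]
    · simp [φ, hlt, h.2.not_gt]
  rw [Finset.prod_sigma', Finset.prod_sigma']
  refine Finset.prod_nbij' φ φ hmem hmem hinv hinv ?_
  rintro ⟨i, j⟩ -
  simp only [φ]
  split_ifs
  · rfl
  · exact hG _ _

/-- The monomial `∏ y_i ^ e_i` in the negated variables with index at least `s`. -/
noncomputable def mon (R : Type*) [CommRing R] (s : ℕ) (e : Fin n → ℕ) : Laurent n R :=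
  ∏ i ∈ blk n s, yv R i ^ e i

theorem mon_add (s : ℕ) (e f : Fin n → ℕ) : mon R s (e + f) = mon R s e * mon R s f := by
  simp [mon, pow_add, Finset.prod_mul_distrib]

theorem mon_eq_mul {s : ℕ} (hs : s < n) (e : Fin n → ℕ) :
    mon R s e = yv R ⟨s, hs⟩ ^ e ⟨s, hs⟩ * mon R (s + 1) e := by
  rw [mon, blk_eq_insert hs, Finset.prod_insert (notMem_blk_succ hs)]
  rfl

theorem mon_congr {s : ℕ} {e f : Fin n → ℕ} (h : ∀ i : Fin n, s ≤ (i : ℕ) → e i = f i) :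
    mon R s e = mon R s f :=
  Finset.prod_congr rfl fun i hi => by rw [h i (mem_blk.1 hi)]

theorem act_swap_mon {s : ℕ} {a b : Fin n} (ha : s ≤ (a : ℕ)) (hb : s ≤ (b : ℕ))
    (e : Fin n → ℕ) : act (Equiv.swap a b) (mon R s e) = mon R s (e ∘ Equiv.swap a b) := by
  rw [mon, mon, map_prod, ← prod_blk_swap ha hb]
  simp [act_yv]

theorem symOn_mon_const (s c : ℕ) : SymOn s (mon R s (fun _ : Fin n => c)) := by
  intro a b ha hb _
  rw [act_swap_mon ha hb]
  rfl

theorem symOn_yv {s : ℕ} {i : Fin n} (h : (i : ℕ) < s) : SymOn s (yv R i) := by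
  rw [yv_eq_subst]
  exact symOn_subst h _

theorem AltOn.mon_eq_zero {s : ℕ} {τ : Laurent n R →ₗ[R] R} (h : AltOn s τ) {a b : Fin n}
    (ha : s ≤ (a : ℕ)) (hb : s ≤ (b : ℕ)) (hab : a ≠ b) {e : Fin n → ℕ} (he : e a = e b) :
    τ (mon R s e) = 0 := by
  refine h.fixed a b ha hb hab _ ?_
  rw [act_swap_mon ha hb]
  refine mon_congr fun i _ => ?_
  simp only [Function.comp, Equiv.swap_apply_def]
  split_ifs with h1 h2
  · rw [h1, he]
  · rw [h2, he]
  · rfl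

/-- The symmetric series `∏ (1 - y_i)⁻¹ ∏_{i<j} (1 - y_i y_j)⁻¹` in the negated variables with
index at least `s`. -/
noncomputable def symSeries (n : ℕ) (R : Type*) [CommRing R] (s : ℕ) : Laurent n R :=
  (∏ i ∈ blk n s, (((onePlusX R i)⁻¹ : (Laurent n R)ˣ) : Laurent n R)) *
    ∏ i ∈ blk n s, ∏ j ∈ Finset.Ioi i, (((oneSubXX R i j)⁻¹ : (Laurent n R)ˣ) : Laurent n R)

theorem symOn_symSeries (s : ℕ) : SymOn s (symSeries n R s) := by
  intro a b ha hb _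
  simp only [symSeries, map_mul, map_prod, act_inv_onePlusX, act_inv_oneSubXX]
  rw [prod_blk_swap ha hb (fun i => (((onePlusX R i)⁻¹ : (Laurent n R)ˣ) : Laurent n R)),
    prod_blk_pairs_swap ha hb
      (fun i j => (((oneSubXX R i j)⁻¹ : (Laurent n R)ˣ) : Laurent n R))
      (fun i j => by rw [oneSubXX_comm])]

/-- `(1 - y_s) ∏_{j>s} (1 - y_s y_j)`. -/
noncomputable def pivot (R : Type*) [CommRing R] {s : ℕ} (hs : s < n) : Laurent n R :=
  (1 - yv R ⟨s, hs⟩) * ∏ j ∈ blk n (s + 1), (1 - yv R ⟨s, hs⟩ * yv R j)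

/-- The pivot consists of exactly the denominators that contain `y_s`. This relates the series for
consecutive `s` in the Littlewood induction. -/
theorem symSeries_mul_pivot {s : ℕ} (hs : s < n) :
    symSeries n R s * pivot R hs = symSeries n R (s + 1) := by
  have h1 : (((onePlusX R ⟨s, hs⟩)⁻¹ : (Laurent n R)ˣ) : Laurent n R) * (1 - yv R ⟨s, hs⟩) = 1 := by
    rw [← coe_onePlusX, Units.inv_mul]
  have h2 : (∏ j ∈ blk n (s + 1), (((oneSubXX R ⟨s, hs⟩ j)⁻¹ : (Laurent n R)ˣ) : Laurent n R)) *
      ∏ j ∈ blk n (s + 1), (1 - yv R ⟨s, hs⟩ * yv R j) = 1 := by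
    rw [← Finset.prod_mul_distrib]
    refine Finset.prod_eq_one fun j _ => ?_
    rw [← coe_oneSubXX, Units.inv_mul]
  rw [symSeries, symSeries, pivot, blk_eq_insert hs, Finset.prod_insert (notMem_blk_succ hs),
    Finset.prod_insert (notMem_blk_succ hs), Ioi_eq_blk hs]
  have h3 := congrArg₂ (· * ·) h1 h2
  simp only [one_mul] at h3
  linear_combination (∏ i ∈ blk n (s + 1),
      (((onePlusX R i)⁻¹ : (Laurent n R)ˣ) : Laurent n R)) *
    (∏ i ∈ blk n (s + 1), ∏ j ∈ Finset.Ioi i,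
      (((oneSubXX R i j)⁻¹ : (Laurent n R)ˣ) : Laurent n R)) * h3

/-! ### A bounded Littlewood identity for alternating functionals -/

/-- The exponents `j - s`, raised by one for the last `r` indices. -/
def stair (n s r : ℕ) : Fin n → ℕ := fun j => (j - s) + if n ≤ (j : ℕ) + r then 1 else 0

/-- Expanding the product raises the staircase exponents on a subset of the indices. If an index is
raised but its successor is not, the two exponents coincide and the term dies. Only final segments
of some length `r` survive. -/
theorem AltOn.expand_prod (s : ℕ) : ∀ (d c : ℕ), c + d = n → s ≤ c →
    ∀ {σ : Laurent n R →ₗ[R] R}, AltOn c σ → ∀ {w : Laurent n R}, SymOn c w →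
    σ (∏ j ∈ blk n c, yv R j ^ ((j : ℕ) - s) * (1 - w * yv R j)) =
      ∑ r ∈ Finset.range (d + 1), σ ((-w) ^ r * mon R c (stair n s r)) := by
  intro d
  induction d with
  | zero =>
    intro c hc _ σ _ w _
    have h : blk n c = ∅ := by
      ext i
      simp only [mem_blk, Finset.notMem_empty, iff_false]
      omega
    simp [mon, h]
  | succ d ih =>
    intro c hc hsc σ hσ w hw
    have hcn : c < n := by omega
    have hsym : SymOn (c + 1) (yv R ⟨c, hcn⟩ ^ (c - s) * (1 - w * yv R ⟨c, hcn⟩)) := by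
      have hy : SymOn (c + 1) (yv R ⟨c, hcn⟩) := symOn_yv (by simp)
      exact (hy.pow _).mul (SymOn.one.sub ((hw.mono (Nat.le_succ c)).mul hy))
    have hih := ih (c + 1) (by omega) (by omega) ((hσ.mono (Nat.le_succ c)).mul_symOn hsym)
      (hw.mono (Nat.le_succ c))
    rw [mulFun_apply] at hih
    rw [blk_eq_insert hcn, Finset.prod_insert (notMem_blk_succ hcn), hih]
    -- Exponents raised at `c` and at the last `r` indices, coming from the summand `-w y_c`. For `r
    -- < d` they collide at `c` and `c + 1`; for `r = d` the whole block is raised.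
    let e : ℕ → Fin n → ℕ := fun r j => (j - s) + if (j : ℕ) = c ∨ n ≤ (j : ℕ) + r then 1 else 0
    have hsplit : ∀ r ∈ Finset.range (d + 1),
        mulFun σ (yv R ⟨c, hcn⟩ ^ (c - s) * (1 - w * yv R ⟨c, hcn⟩))
          ((-w) ^ r * mon R (c + 1) (stair n s r)) =
        σ ((-w) ^ r * mon R c (stair n s r)) + σ ((-w) ^ (r + 1) * mon R c (e r)) := by
      intro r hr
      rw [Finset.mem_range] at hr
      rw [mulFun_apply, ← map_add]
      congr 1
      rw [mon_eq_mul hcn, mon_eq_mul hcn (e r)]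
      have h1 : stair n s r ⟨c, hcn⟩ = c - s := by
        simp only [stair]
        rw [if_neg (by omega), add_zero]
      have h2 : e r ⟨c, hcn⟩ = c - s + 1 := by simp [e]
      have h3 : mon R (c + 1) (e r) = mon R (c + 1) (stair n s r) := by
        refine mon_congr fun i hi => ?_
        simp only [e, stair]
        congr 2
        simp only [eq_iff_iff, or_iff_right_iff_imp]
        omega
      rw [h1, h2, h3]
      ring
    rw [Finset.sum_congr rfl hsplit, Finset.sum_add_distrib, Finset.sum_range_succ _ (d + 1)]
    congr 1
    rw [Finset.sum_eq_single d]
    · congr 2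
      refine mon_congr fun i hi => ?_
      simp only [e, stair]
      congr 2
      simp only [eq_iff_iff]
      omega
    · intro r hr hne
      rw [Finset.mem_range] at hr
      have hrd : r < d := by omega
      have hc1 : c + 1 < n := by omega
      rw [← mulFun_apply]
      refine (hσ.mul_symOn (hw.neg.pow (r + 1))).mon_eq_zero (a := ⟨c, hcn⟩) (b := ⟨c + 1, hc1⟩)
        le_rfl (Nat.le_succ c) (by simp [Fin.ext_iff]) ?_
      simp only [e, true_or, if_true]
      rw [if_neg (by omega)]
      omega
    · simp

/-- Exponents with `p` at the index `s` and a staircase with one gap above. -/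
def gapExp (n s p r : ℕ) : Fin n → ℕ := fun j => if (j : ℕ) = s then p else stair n s r j

/-- Above `s` the exponents are `1, …, k` with only `k - r` missing. Any other `p` in this range
already occurs, at index `s + p` below the gap or `s + p - 1` above it. -/
theorem AltOn.gap_eq_zero {s : ℕ} {τ : Laurent n R →ₗ[R] R} (hτ : AltOn s τ) {p r k : ℕ}
    (hk : s + k = n) (hp : 1 ≤ p) (hpk : p ≤ k) (hr : r < k) (hne : p + r ≠ k) :
    τ (mon R s (gapExp n s p r)) = 0 := by
  rcases lt_or_gt_of_ne hne with h | h
  · refine hτ.mon_eq_zero (a := ⟨s, by omega⟩) (b := ⟨s + p, by omega⟩) le_rfl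
      (Nat.le_add_right _ _) (by simp [Fin.ext_iff]; omega) ?_
    simp only [gapExp, stair, if_true]
    rw [if_neg (by omega), if_neg (by omega)]
    omega
  · by_cases hp1 : p = 1
    · omega
    refine hτ.mon_eq_zero (a := ⟨s, by omega⟩) (b := ⟨s + (p - 1), by omega⟩) le_rfl
      (Nat.le_add_right _ _) (by simp [Fin.ext_iff]; omega) ?_
    simp only [gapExp, stair, if_true]
    rw [if_neg (by omega), if_pos (by omega)]
    omega

/-- When `p` fills the gap, the exponents are a permutation of `1, …, k`. Swapping `s` with `s + p`
raises `p` by one, so each step costs a sign. -/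
theorem AltOn.gap_eq {s : ℕ} {τ : Laurent n R →ₗ[R] R} (hτ : AltOn s τ) {k : ℕ}
    (hk : s + k = n) (p : ℕ) (hpk : p + 1 ≤ k) :
    τ (mon R s (gapExp n s (p + 1) (k - (p + 1)))) =
      (-1) ^ p * τ (mon R s (gapExp n s 1 (k - 1))) := by
  induction p with
  | zero => simp
  | succ p ih =>
    have hs : s < n := by omega
    have hsp : s + (p + 1) < n := by omega
    have h := hτ.swap ⟨s, hs⟩ ⟨s + (p + 1), hsp⟩ le_rfl (Nat.le_add_right _ _)
      (by simp [Fin.ext_iff]) (mon R s (gapExp n s (p + 1) (k - (p + 1))))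
    rw [ih (by omega), act_swap_mon (by simp) (by simp)] at h
    rw [pow_succ, mul_neg_one, neg_mul, ← h]
    congr 1
    refine mon_congr fun i hi => ?_
    simp only [Function.comp, Equiv.swap_apply_def, gapExp, stair, Fin.ext_iff]
    by_cases h1 : (i : ℕ) = s
    · simp only [h1, if_true]
      rw [if_neg (by omega), if_pos (by omega)]
      omega
    · by_cases h2 : (i : ℕ) = s + (p + 1)
      · simp only [h2, if_true]
        rw [if_neg (by omega), if_neg (by omega)]
        simp
      · simp only [h1, h2, if_false]
        congr 2
        simp only [eq_iff_iff]
        omega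

/-- Besides `f 0 0`, a term can survive only on `p + r = k`. The two families have `p + r = 2r` and
`p + r = 2r + 1`, so the parity of `k` selects exactly one term, and in both parities its total sign
is negative. -/
theorem alternating_sum_gap {k : ℕ} (hk : 1 ≤ k) (f : ℕ → ℕ → R) (t : R)
    (h0 : ∀ p r, 1 ≤ p → p ≤ k → r < k → p + r ≠ k → f p r = 0)
    (h1 : ∀ p, p + 1 ≤ k → f (p + 1) (k - (p + 1)) = (-1) ^ p * t) :
    ∑ r ∈ Finset.range k, (-1) ^ r * (f r r - f (r + 1) r) = f 0 0 - t := by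
  obtain ⟨l, rfl⟩ : ∃ l, k = l + 1 := ⟨k - 1, by omega⟩
  simp only [mul_sub, Finset.sum_sub_distrib]
  rw [Finset.sum_range_succ']
  obtain ⟨q, hq | hq⟩ := Nat.even_or_odd' l
  · rw [Finset.sum_eq_zero, Finset.sum_eq_single q]
    · have := h1 q (by omega)
      rw [show l + 1 - (q + 1) = q by omega] at this
      rw [this, ← mul_assoc, ← mul_pow]
      simp
    · intro r hr hne
      rw [Finset.mem_range] at hr
      rw [h0 _ _ (by omega) (by omega) (by omega) (by omega), mul_zero]
    · intro h
      exact absurd (Finset.mem_range.2 (by omega)) h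
    · intro r hr
      rw [Finset.mem_range] at hr
      rw [h0 _ _ (by omega) (by omega) (by omega) (by omega), mul_zero]
  · rw [Finset.sum_eq_single q, Finset.sum_eq_zero]
    · have := h1 q (by omega)
      rw [show l + 1 - (q + 1) = q + 1 by omega] at this
      have hsq : ((-1 : R) ^ q) * (-1) ^ q = 1 := by rw [← mul_pow]; simp
      rw [this, pow_succ]
      linear_combination (-t) * hsq
    · intro r hr
      rw [Finset.mem_range] at hr
      rw [h0 _ _ (by omega) (by omega) (by omega) (by omega), mul_zero]
    · intro r hr hne
      rw [Finset.mem_range] at hr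
      rw [h0 _ _ (by omega) (by omega) (by omega) (by omega), mul_zero]
    · intro h
      exact absurd (Finset.mem_range.2 (by omega)) h

/-- After `AltOn.expand_prod` with `w = y_s`, every term is a monomial whose exponent at `s` is `r`
or `r + 1`, above a staircase with one gap. All but two cancel: the untouched staircase and the
staircase raised everywhere. -/
theorem AltOn.pivot_eq {s : ℕ} (hs : s < n) {τ : Laurent n R →ₗ[R] R} (hτ : AltOn s τ) :
    τ (mon R s (fun j : Fin n => (j : ℕ) - s) * pivot R hs) =
      τ (mon R s (fun j : Fin n => (j : ℕ) - s) * (1 - mon R s (fun _ : Fin n => 1))) := by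
  obtain ⟨k, hk⟩ : ∃ k, s + k = n := ⟨n - s, by omega⟩
  set w := yv R (⟨s, hs⟩ : Fin n) with hw
  have hsym : SymOn (s + 1) w := symOn_yv (by simp)
  have h := AltOn.expand_prod s (k - 1) (s + 1) (by omega) (Nat.le_succ s)
    ((hτ.mono (Nat.le_succ s)).mul_symOn (SymOn.one.sub hsym)) hsym
  rw [show k - 1 + 1 = k by omega] at h
  have hL : mon R s (fun j : Fin n => (j : ℕ) - s) * pivot R hs =
      (1 - w) * ∏ j ∈ blk n (s + 1), yv R j ^ ((j : ℕ) - s) * (1 - w * yv R j) := by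
    rw [mon_eq_mul hs, pivot, Finset.prod_mul_distrib, mon]
    simp only [← hw, Nat.sub_self, pow_zero]
    ring
  have hgap : ∀ p r, mon R s (gapExp n s p r) = w ^ p * mon R (s + 1) (stair n s r) := by
    intro p r
    rw [mon_eq_mul hs]
    congr 1
    · simp [gapExp, hw]
    · refine mon_congr fun i hi => ?_
      simp only [gapExp]
      rw [if_neg (by omega)]
  have hR : ∀ r, mulFun τ (1 - w) ((-w) ^ r * mon R (s + 1) (stair n s r)) =
      (-1) ^ r * (τ (mon R s (gapExp n s r r)) - τ (mon R s (gapExp n s (r + 1) r))) := by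
    intro r
    rw [mulFun_apply, hgap, hgap, ← map_sub]
    have : (1 - w) * ((-w) ^ r * mon R (s + 1) (stair n s r)) = ((-1) ^ r : R) •
        (w ^ r * mon R (s + 1) (stair n s r) - w ^ (r + 1) * mon R (s + 1) (stair n s r)) := by
      rw [neg_pow, Algebra.smul_def, map_pow, map_neg, map_one]
      ring
    rw [this, map_smul, smul_eq_mul]
  rw [hL, ← mulFun_apply, h, Finset.sum_congr rfl fun r _ => hR r,
    alternating_sum_gap (by omega) (fun p r => τ (mon R s (gapExp n s p r))) _
      (fun p r hp hpk hr hne => hτ.gap_eq_zero hk hp hpk hr hne)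
      (fun p hp => hτ.gap_eq hk p hp), mul_sub, mul_one, map_sub, ← mon_add]
  congr 2
  · refine mon_congr fun i hi => ?_
    simp only [gapExp, stair]
    split_ifs <;> omega
  · refine mon_congr fun i hi => ?_
    simp only [gapExp, stair, Pi.add_apply]
    split_ifs <;> omega

/-! ### Bounded heights and the Littlewood induction -/

/-- Weakly increasing heights less than `N` at the indices at least `s`, and `0` elsewhere. -/
def heights (n s N : ℕ) : Finset (Fin n → ℕ) :=
  (Fintype.piFinset fun _ : Fin n => Finset.range (N + 1)).filter fun h =>
    (∀ i : Fin n, (i : ℕ) < s → h i = 0) ∧ (∀ i : Fin n, s ≤ (i : ℕ) → h i < N) ∧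
    ∀ i j : Fin n, s ≤ (i : ℕ) → i ≤ j → h i ≤ h j

theorem mem_heights {s N : ℕ} {h : Fin n → ℕ} : h ∈ heights n s N ↔
    (∀ i : Fin n, (i : ℕ) < s → h i = 0) ∧ (∀ i : Fin n, s ≤ (i : ℕ) → h i < N) ∧
    ∀ i j : Fin n, s ≤ (i : ℕ) → i ≤ j → h i ≤ h j := by
  simp only [heights, Finset.mem_filter, and_iff_right_iff_imp, Fintype.mem_piFinset,
    Finset.mem_range]
  intro hh i
  rcases lt_or_ge (i : ℕ) s with hi | hi
  · rw [hh.1 i hi]; omega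
  · have := hh.2.1 i hi
    omega

/-- If the smallest height is positive, then all heights of the block are, and one can be subtracted
from each of them. -/
theorem sum_heights_filter_pos {M : Type*} [AddCommMonoid M] {s : ℕ} (hs : s < n) (N : ℕ)
    (f : (Fin n → ℕ) → M) :
    ∑ h ∈ (heights n s (N + 1)).filter (fun h => h ⟨s, hs⟩ ≠ 0), f h =
      ∑ h ∈ heights n s N, f (h + fun i : Fin n => if s ≤ (i : ℕ) then 1 else 0) := by
  symm
  refine Finset.sum_nbij' (fun h => h + fun i : Fin n => if s ≤ (i : ℕ) then 1 else 0)
    (fun h i => h i - 1) ?_ ?_ ?_ ?_ (fun _ _ => rfl)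
  · intro h hh
    rw [mem_heights] at hh
    simp only [Finset.mem_filter, mem_heights, Pi.add_apply]
    refine ⟨⟨fun i hi => ?_, fun i hi => ?_, fun i j hi hij => ?_⟩, ?_⟩
    · rw [hh.1 i hi, if_neg (by omega)]
    · have := hh.2.1 i hi
      rw [if_pos hi]; omega
    · have := hh.2.2 i j hi hij
      rw [if_pos hi, if_pos (hi.trans hij)]; omega
    · simp
  · intro h hh
    simp only [Finset.mem_filter, mem_heights] at hh
    have hpos : ∀ i : Fin n, s ≤ (i : ℕ) → 0 < h i := fun i hi =>
      lt_of_lt_of_le (Nat.pos_of_ne_zero hh.2) (hh.1.2.2 ⟨s, hs⟩ i le_rfl hi)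
    rw [mem_heights]
    refine ⟨fun i hi => ?_, fun i hi => ?_, fun i j hi hij => ?_⟩
    · rw [hh.1.1 i hi]
    · have := hh.1.2.1 i hi
      have := hpos i hi
      omega
    · have := hh.1.2.2 i j hi hij
      omega
  · intro h hh
    rw [mem_heights] at hh
    funext i
    by_cases hi : s ≤ (i : ℕ)
    · simp [hi]
    · simp [hi, hh.1 i (not_le.1 hi)]
  · intro h hh
    simp only [Finset.mem_filter, mem_heights] at hh
    funext i
    by_cases hi : s ≤ (i : ℕ)
    · have : 0 < h i :=
        lt_of_lt_of_le (Nat.pos_of_ne_zero hh.2) (hh.1.2.2 ⟨s, hs⟩ i le_rfl hi)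
      simp only [Pi.add_apply, hi, if_true]
      omega
    · simp [hi, hh.1.1 i (not_le.1 hi)]

theorem heights_filter_zero {s : ℕ} (hs : s < n) (N : ℕ) :
    (heights n s (N + 1)).filter (fun h => ¬ h ⟨s, hs⟩ ≠ 0) = heights n (s + 1) (N + 1) := by
  ext h
  simp only [Finset.mem_filter, mem_heights, ne_eq, not_not]
  constructor
  · rintro ⟨⟨h1, h2, h3⟩, h4⟩
    refine ⟨fun i hi => ?_, fun i hi => h2 i (by omega), fun i j hi => h3 i j (by omega)⟩
    rcases Nat.lt_succ_iff_lt_or_eq.1 hi with hi | hi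
    · exact h1 i hi
    · rw [← h4]; congr 1; exact Fin.ext hi
  · rintro ⟨h1, h2, h3⟩
    have h0 : ∀ i : Fin n, (i : ℕ) = s → h i = 0 := fun i hi => h1 i (by omega)
    refine ⟨⟨fun i hi => h1 i (by omega), fun i hi => ?_, fun i j hi hij => ?_⟩, h0 _ rfl⟩
    · rcases Nat.lt_or_eq_of_le hi with hi | hi
      · exact h2 i hi
      · rw [h0 i hi.symm]; omega
    · rcases Nat.lt_or_eq_of_le hi with hi | hi
      · exact h3 i j hi hij
      · rw [h0 i hi.symm]; omega

theorem ordGE_of_mem_range {f : Laurent n R} (hf : f ∈ (ofPowerSeries n R).range) (i : Fin n) :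
    OrdGE i 0 f := by
  obtain ⟨g, rfl⟩ := hf
  intro e he
  obtain ⟨d, -, rfl⟩ := HahnSeries.support_embDomain_subset ((HahnSeries.mem_support _ _).2 he)
  simp [natExp]

theorem inv_mem_range {u : (Laurent n R)ˣ} {p : MvPowerSeries (Fin n) R} (hp : IsUnit p)
    (hu : (u : Laurent n R) = ofPowerSeries n R p) :
    ((u⁻¹ : (Laurent n R)ˣ) : Laurent n R) ∈ (ofPowerSeries n R).range := by
  obtain ⟨p, rfl⟩ := hp
  have : u = Units.map (ofPowerSeries n R).toMonoidHom p := by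
    ext1
    exact hu
  exact ⟨((p⁻¹ : (MvPowerSeries (Fin n) R)ˣ) : MvPowerSeries (Fin n) R), by rw [this, ← map_inv]; rfl⟩

theorem yv_mem_range (i : Fin n) : yv R i ∈ (ofPowerSeries n R).range :=
  neg_mem ⟨_, ofPowerSeries_X i⟩

theorem mon_mem_range (s : ℕ) (e : Fin n → ℕ) : mon R s e ∈ (ofPowerSeries n R).range :=
  prod_mem fun i _ => pow_mem (yv_mem_range i) _

theorem symSeries_mem_range (s : ℕ) : symSeries n R s ∈ (ofPowerSeries n R).range := by
  refine mul_mem (prod_mem fun i _ => ?_) (prod_mem fun i _ => prod_mem fun j _ => ?_)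
  · refine inv_mem_range (p := 1 + MvPowerSeries.X i) ?_ ?_
    · rw [MvPowerSeries.isUnit_iff_constantCoeff]; simp
    · rw [onePlusX, IsUnit.unit_spec, map_add, map_one, ofPowerSeries_X]
  · refine inv_mem_range (p := 1 - MvPowerSeries.X i * MvPowerSeries.X j) ?_ ?_
    · rw [MvPowerSeries.isUnit_iff_constantCoeff]; simp
    · rw [oneSubXX, IsUnit.unit_spec, map_sub, map_one, map_mul, ofPowerSeries_X, ofPowerSeries_X]

theorem ordGE_mon_one {s : ℕ} {i : Fin n} (hi : s ≤ (i : ℕ)) :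
    OrdGE i 1 (mon R s (fun _ : Fin n => 1)) := by
  rw [mon, ← Finset.mul_prod_erase _ _ (mem_blk.2 hi), pow_one, ← add_zero (1 : ℤ)]
  refine OrdGE.mul ?_ (ordGE_of_mem_range (prod_mem fun j _ => pow_mem (yv_mem_range j) _) i)
  rw [yv_eq_subst]
  refine ordGE_subst_self fun t ht => ?_
  by_contra h
  refine ht ?_
  rw [HahnSeries.coeff_neg, HahnSeries.coeff_single_of_ne (by omega), neg_zero]

/-- The functional vanishes on series of order at least `N` in some variable with index at least
`s`. -/
def VanishGE (s : ℕ) (N : ℕ) (τ : Laurent n R →ₗ[R] R) : Prop :=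
  ∀ i : Fin n, s ≤ (i : ℕ) → ∀ f, OrdGE i N f → τ f = 0

theorem VanishGE.mul_of_mem_range {s N : ℕ} {τ : Laurent n R →ₗ[R] R} (h : VanishGE s N τ)
    {g : Laurent n R} (hg : g ∈ (ofPowerSeries n R).range) : VanishGE s N (mulFun τ g) :=
  fun i hi f hf => h i hi _ (by simpa using (ordGE_of_mem_range hg i).mul hf)

/-- Multiplication by the product of the block variables raises each of their orders by one. This
matches the drop of the height bound when one is subtracted from all heights. -/
theorem VanishGE.mul_mon_one {s N : ℕ} {τ : Laurent n R →ₗ[R] R} (h : VanishGE s (N + 1) τ) :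
    VanishGE s N (mulFun τ (mon R s fun _ : Fin n => 1)) := fun i hi f hf =>
  h i hi _ (((ordGE_mon_one hi).mul hf).mono (by push_cast; omega))

theorem VanishGE.mono {s t N : ℕ} {τ : Laurent n R →ₗ[R] R} (h : VanishGE s N τ) (hst : s ≤ t) :
    VanishGE t N τ := fun i hi => h i (hst.trans hi)

theorem mon_sub_eq {s : ℕ} (hs : s < n) : mon R s (fun j : Fin n => (j : ℕ) - s) =
    mon R (s + 1) (fun _ : Fin n => 1) * mon R (s + 1) (fun j : Fin n => (j : ℕ) - (s + 1)) := by
  rw [mon_eq_mul hs, ← mon_add]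
  simp only [Nat.sub_self, pow_zero, one_mul]
  refine mon_congr fun i hi => ?_
  simp only [Pi.add_apply]
  omega

theorem sum_heights_zero {s N : ℕ} (hs : s < n)
    (ih : ∀ {τ : Laurent n R →ₗ[R] R}, AltOn (s + 1) τ → VanishGE (s + 1) N τ →
      ∑ h ∈ heights n (s + 1) N, τ (mon R (s + 1) (fun j : Fin n => (j : ℕ) - (s + 1)) * mon R (s + 1) h) =
        τ (mon R (s + 1) (fun j : Fin n => (j : ℕ) - (s + 1)) * symSeries n R (s + 1)))
    {τ : Laurent n R →ₗ[R] R} (hτ : AltOn s τ) (hN : VanishGE s N τ) :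
    ∑ h ∈ heights n (s + 1) N, τ (mon R s (fun j : Fin n => (j : ℕ) - s) * mon R s h) =
      τ (mon R s (fun j : Fin n => (j : ℕ) - s) * symSeries n R (s + 1)) := by
  have h := ih ((hτ.mono (Nat.le_succ s)).mul_symOn (symOn_mon_const (s + 1) 1))
    ((hN.mono (Nat.le_succ s)).mul_of_mem_range (mon_mem_range (s + 1) _))
  simp only [mulFun_apply, ← mul_assoc, ← mon_sub_eq hs] at h
  rw [← h]
  refine Finset.sum_congr rfl fun e he => ?_
  rw [mem_heights] at he
  rw [mon_eq_mul hs e, he.1 ⟨s, hs⟩ (Nat.lt_succ_self s), pow_zero, one_mul]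

theorem sum_heights_pos {s N : ℕ} (hs : s < n)
    (ih : ∀ {τ : Laurent n R →ₗ[R] R}, AltOn s τ → VanishGE s N τ →
      ∑ h ∈ heights n s N, τ (mon R s (fun j : Fin n => (j : ℕ) - s) * mon R s h) =
        τ (mon R s (fun j : Fin n => (j : ℕ) - s) * symSeries n R s))
    {τ : Laurent n R →ₗ[R] R} (hτ : AltOn s τ) (hN : VanishGE s (N + 1) τ) :
    ∑ h ∈ (heights n s (N + 1)).filter (fun h => h ⟨s, hs⟩ ≠ 0),
      τ (mon R s (fun j : Fin n => (j : ℕ) - s) * mon R s h) =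
      τ (mon R s (fun _ : Fin n => 1) * (mon R s (fun j : Fin n => (j : ℕ) - s) * symSeries n R s)) := by
  rw [sum_heights_filter_pos, ← mulFun_apply,
    ← ih (hτ.mul_symOn (symOn_mon_const s 1)) hN.mul_mon_one]
  refine Finset.sum_congr rfl fun e he => ?_
  rw [mulFun_apply, mon_add, mon_congr (f := fun _ => 1) (fun i hi => if_pos hi)]
  congr 1
  ring

/-- The bounded Littlewood identity for alternating functionals. -/
theorem sum_heights_eq {s : ℕ} (hs : s ≤ n) : ∀ (N : ℕ) {τ : Laurent n R →ₗ[R] R}, AltOn s τ →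
    VanishGE s N τ → ∑ h ∈ heights n s N, τ (mon R s (fun j : Fin n => (j : ℕ) - s) * mon R s h) =
      τ (mon R s (fun j : Fin n => (j : ℕ) - s) * symSeries n R s) := by
  induction hs using Nat.decreasingInduction with
  | self =>
    intro N τ _ _
    have h : blk n n = ∅ := by
      ext i
      simp
    have h' : heights n n N = {0} := by
      ext e
      simp only [mem_heights, Finset.mem_singleton, funext_iff]
      refine ⟨fun he i => he.1 i i.2, fun he => ⟨fun i _ => he i, fun i hi => ?_, fun i j hi => ?_⟩⟩
      · exact absurd hi (not_le.2 i.2)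
      · exact absurd hi (not_le.2 i.2)
    simp [h', symSeries, mon, h]
  | of_succ s hs ih =>
    intro N
    induction N with
    | zero =>
      intro τ _ hN
      have h' : heights n s 0 = ∅ := by
        ext e
        simp only [mem_heights, Finset.notMem_empty, iff_false]
        rintro ⟨-, h, -⟩
        exact absurd (h ⟨s, hs⟩ le_rfl) (Nat.not_lt_zero _)
      -- No heights are available, and the right side vanishes too, since it is `τ` of a genuine
      -- power series.
      rw [h', Finset.sum_empty, hN ⟨s, hs⟩ le_rfl]
      exact ordGE_of_mem_range (mul_mem (mon_mem_range _ _) (symSeries_mem_range _)) _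
    | succ N ihN =>
      intro τ hτ hN
      rw [← Finset.sum_filter_add_sum_filter_not _ (fun h : Fin n → ℕ => h ⟨s, hs⟩ ≠ 0),
        heights_filter_zero, sum_heights_zero hs (ih (N + 1)) hτ hN, sum_heights_pos hs ihN hτ hN]
      -- Zero smallest height contributes `y^δ · symSeries (s+1)`, which is `y^δ · symSeries s ·
      -- pivot`; by the pivot identity this has the same value as `y^δ · symSeries s · (1 - ∏ y)`.
      -- Positive smallest height supplies the missing `∏ y`.
      have h := (hτ.mul_symOn (symOn_symSeries s)).pivot_eq hs
      rw [mulFun_apply, mulFun_apply, mul_left_comm, symSeries_mul_pivot] at h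
      rw [h, ← map_add]
      congr 1
      ring

/-- The Littlewood identity with an additional weight for a vanishing smallest height. -/
theorem sum_heights_weighted {s : ℕ} (hs : s < n) (N : ℕ) {τ : Laurent n R →ₗ[R] R}
    (hτ : AltOn s τ) (hN : VanishGE s (N + 1) τ) (Q : R) :
    ∑ h ∈ heights n s (N + 1), (if h ⟨s, hs⟩ = 0 then Q else 1) *
      τ (mon R s (fun j : Fin n => (j : ℕ) - s) * mon R s h) =
      τ (mon R s (fun j : Fin n => (j : ℕ) - s) * symSeries n R s *
        (Q • pivot R hs + mon R s (fun _ : Fin n => 1))) := by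
  have h1 := sum_heights_zero hs (sum_heights_eq hs (N + 1)) hτ hN
  have h2 := sum_heights_pos hs (sum_heights_eq hs.le N) hτ hN
  rw [← Finset.sum_filter_add_sum_filter_not _ (fun h : Fin n → ℕ => h ⟨s, hs⟩ ≠ 0),
    heights_filter_zero, Finset.sum_congr rfl (g := fun h => τ (mon R s (fun j : Fin n => (j : ℕ) - s) *
      mon R s h)), h2, Finset.sum_congr rfl (s₁ := heights n (s + 1) (N + 1)) (g := fun h =>
        Q * τ (mon R s (fun j : Fin n => (j : ℕ) - s) * mon R s h)), ← Finset.mul_sum, h1,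
    ← symSeries_mul_pivot hs, mul_add, map_add, mul_smul_comm, map_smul, smul_eq_mul, add_comm]
  · rw [← mul_assoc, mul_comm (mon R s fun _ : Fin n => 1)]
  · intro h hh
    rw [mem_heights] at hh
    rw [if_pos (hh.1 _ (Nat.lt_succ_self s))]
  · intro h hh
    rw [if_neg (Finset.mem_filter.1 hh).2, one_mul]

end Magog

namespace Magog

/-! ### Telescoping sums for alternating multilinear forms -/

/-- Weakly increasing sequences that dominate `c` and agree with it from the index `t` on. -/
def between {n : ℕ} (t : ℕ) (c : Fin n → ℕ) : Finset (Fin n → ℕ) :=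
  (Fintype.piFinset fun i => Finset.Icc (c i) (Finset.univ.sup c)).filter fun b =>
    Monotone b ∧ ∀ i : Fin n, t ≤ (i : ℕ) → b i = c i

theorem mem_between {n t : ℕ} (ht : t < n) {c b : Fin n → ℕ} :
    b ∈ between t c ↔ c ≤ b ∧ Monotone b ∧ ∀ i : Fin n, t ≤ (i : ℕ) → b i = c i := by
  simp only [between, Finset.mem_filter, Fintype.mem_piFinset, Finset.mem_Icc]
  constructor
  · rintro ⟨h1, h2⟩
    exact ⟨fun i => (h1 i).1, h2⟩
  · rintro ⟨h1, h2, h3⟩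
    refine ⟨fun i => ⟨h1 i, ?_⟩, h2, h3⟩
    -- As `t < n`, the last entry is pinned to that of `c`, so the finite upper bound in the
    -- definition loses nothing.
    have hl : b i ≤ b ⟨n - 1, by omega⟩ := h2 (Fin.le_def.2 (by simp; omega))
    rw [h3 ⟨n - 1, by omega⟩ (by simp; omega)] at hl
    exact hl.trans (Finset.le_sup (Finset.mem_univ _))

theorem sum_Icc_sub {V : Type*} [AddCommGroup V] (s G : ℕ → V)
    (h : ∀ b, 1 ≤ b → s b = G b - G (b + 1)) {a b : ℕ} (ha : 1 ≤ a) (hab : a ≤ b) :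
    ∑ v ∈ Finset.Icc a b, s v = G a - G (b + 1) := by
  induction b, hab using Nat.le_induction with
  | base => rw [Finset.Icc_self, Finset.sum_singleton, h a ha]
  | succ b hb ih =>
    rw [Finset.sum_Icc_succ_top (by omega), ih, h (b + 1) (by omega)]
    abel

theorem AlternatingMap.map_update_eq_zero_of_smul {R V ι : Type*} [CommRing R] [AddCommGroup V]
    [Module R V] [DecidableEq ι] (A : V [⋀^ι]→ₗ[R] R) (W : ι → V) {i j : ι} (hij : i ≠ j) (g : V)
    (r : R) (h : W j = r • g) : A (Function.update W i g) = 0 := by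
  have h1 : Function.update W i g = Function.update (Function.update W i g) j (r • g) := by
    rw [← h]
    funext l
    by_cases hl : l = j
    · subst hl
      rw [Function.update_self, Function.update_of_ne hij.symm]
    · rw [Function.update_of_ne hl]
  rw [h1, A.map_update_smul, A.map_eq_zero_of_eq _ (i := i) (j := j) _ hij, smul_zero]
  rw [Function.update_self, Function.update_of_ne hij, Function.update_self]

/-- Induction on the number of free slots, fixing the value of the topmost one. Each free slot
telescopes between its lower bound and the value in the next slot; its upper boundary term is
proportional to the vector standing in that next slot, so the form vanishes on it. -/
theorem sum_between {R V : Type*} [CommRing R] [AddCommGroup V] [Module R V] {n : ℕ}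
    (A : V [⋀^Fin n]→ₗ[R] R) (s G : Fin n → ℕ → V) (t : ℕ) (ht : t < n)
    (hG : ∀ i : Fin n, (i : ℕ) < t → ∀ b, 1 ≤ b → s i b = G i b - G i (b + 1))
    (hs : ∀ i j : Fin n, (j : ℕ) = i + 1 → (i : ℕ) < t → ∀ b, 1 ≤ b →
      ∃ r : R, s j b = r • G i (b + 1))
    (c : Fin n → ℕ) (hc : Monotone c) (hc1 : ∀ i, 1 ≤ c i) :
    ∑ b ∈ between t c, A (fun i => s i (b i)) =
      A (fun i => if (i : ℕ) < t then G i (c i) else s i (c i)) := by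
  induction t generalizing c with
  | zero =>
    have h : between 0 c = {c} := by
      ext b
      rw [mem_between ht, Finset.mem_singleton]
      refine ⟨fun h => funext fun i => h.2.2 i (Nat.zero_le _), ?_⟩
      rintro rfl
      exact ⟨le_rfl, hc, fun _ _ => rfl⟩
    simp [h]
  | succ t ih =>
    set p : Fin n := ⟨t, by omega⟩ with hp
    set q : Fin n := ⟨t + 1, ht⟩ with hq
    have hpq : p ≠ q := by simp [hp, hq]
    have hpq' : p ≤ q := Fin.le_def.2 (by simp [hp, hq])
    have hpv : (p : ℕ) = t := rfl
    have hmaps : ∀ b ∈ between (t + 1) c, b p ∈ Finset.Icc (c p) (c q) := by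
      intro b hb
      rw [mem_between ht] at hb
      rw [Finset.mem_Icc, ← hb.2.2 q le_rfl]
      exact ⟨hb.1 p, hb.2.1 hpq'⟩
    have hupd : ∀ v ∈ Finset.Icc (c p) (c q), Monotone (Function.update c p v) := by
      intro v hv i j hij
      rw [Finset.mem_Icc] at hv
      simp only [Function.update_apply]
      split_ifs with h1 h2 h2
      · rfl
      · refine hv.2.trans (hc (Fin.le_def.2 ?_))
        rw [h1] at hij
        have : (p : ℕ) < j := lt_of_le_of_ne (Fin.le_def.1 hij) fun h => h2 (Fin.ext h.symm)
        exact this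
      · exact (hc (h2 ▸ hij)).trans hv.1
      · exact hc hij
    have hfib : ∀ v ∈ Finset.Icc (c p) (c q),
        (between (t + 1) c).filter (fun b => b p = v) = between t (Function.update c p v) := by
      intro v hv
      rw [Finset.mem_Icc] at hv
      ext b
      rw [Finset.mem_filter, mem_between ht, mem_between (by omega)]
      constructor
      · rintro ⟨⟨h1, h2, h3⟩, h4⟩
        refine ⟨fun i => ?_, h2, fun i hi => ?_⟩
        · rw [Function.update_apply]
          split_ifs with h
          · rw [h, h4]
          · exact h1 i
        · rw [Function.update_apply]
          split_ifs with h
          · rw [h, h4]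
          · exact h3 i (Nat.lt_of_le_of_ne hi fun h' => h (Fin.ext h'.symm))
      · rintro ⟨h1, h2, h3⟩
        have h4 := h3 p le_rfl
        rw [Function.update_self] at h4
        refine ⟨⟨fun i => ?_, h2, fun i hi => ?_⟩, h4⟩
        · have := h1 i
          rw [Function.update_apply] at this
          split_ifs at this with h
          · rw [h]; exact hv.1.trans (h4 ▸ le_rfl)
          · exact this
        · rw [h3 i (by omega), Function.update_of_ne]
          rintro rfl
          omega
    set W : Fin n → V := fun i => if (i : ℕ) < t then G i (c i) else s i (c i) with hW
    have hterm : ∀ v ∈ Finset.Icc (c p) (c q),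
        ∑ b ∈ (between (t + 1) c).filter (fun b => b p = v), A (fun i => s i (b i)) =
          A (Function.update W p (s p v)) := by
      intro v hv
      rw [hfib v hv, ih (by omega) (fun i hi => hG i (by omega))
        (fun i j hj hi => hs i j hj (by omega)) _ (hupd v hv)]
      · congr 1
        funext i
        by_cases h : i = p
        · subst h
          simp [hpv]
        · simp [h, hW]
      · intro i
        rw [Function.update_apply]
        split_ifs
        · exact (hc1 p).trans (Finset.mem_Icc.1 hv).1
        · exact hc1 i
    rw [← Finset.sum_fiberwise_of_maps_to hmaps, Finset.sum_congr rfl hterm, ← A.map_update_sum,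
      sum_Icc_sub (s p) (G p) (hG p (Nat.lt_succ_self t)) (hc1 p) (hc hpq'), A.map_update_sub]
    -- Slot `q` still holds `s q (c q)`, a multiple of the boundary vector `G p (c q + 1)`.
    obtain ⟨r, hr⟩ := hs p q rfl (Nat.lt_succ_self t) (c q) (hc1 q)
    rw [AlternatingMap.map_update_eq_zero_of_smul A W hpq (G p (c q + 1)) r, sub_zero]
    · congr 1
      funext i
      by_cases h : i = p
      · subst h
        simp [hp]
      · have : (i : ℕ) ≠ t := fun h' => h (Fin.ext h')
        simp only [Function.update_of_ne h, hW]
        congr 1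
        simp only [eq_iff_iff]
        omega
    · rw [← hr, hW]
      simp [hq]

/-! ### The columns of a trapezoid -/

/-- The position in row `i` and column `j`, both zero-based. -/
def cell {n k : ℕ} (i j : ℕ) (hj : j < k) (h : i + j < n) : Cell n k :=
  ⟨(⟨i, by omega⟩, ⟨j, hj⟩), h⟩

theorem exists_cell {n k : ℕ} (c : Cell n k) : ∃ i j hj h, c = cell i j hj h :=
  ⟨c.1.1, c.1.2, c.1.2.2, c.2, rfl⟩

theorem isTrapezoid_iff {m n k : ℕ} {a : Cell n k → ℕ} : IsTrapezoid m n k a ↔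
    (∀ i j hj h, 1 ≤ a (cell i j hj h)) ∧ (∀ i j hj h, a (cell i j hj h) ≤ m + (i + 1)) ∧
    ∀ i j hj h i' j' hj' h', i ≤ i' → j' ≤ j → a (cell i j hj h) ≤ a (cell i' j' hj' h') := by
  constructor
  · intro H
    refine ⟨fun i j hj h => H.pos _, fun i j hj h => H.le_bound _, ?_⟩
    intro i j hj h i' j' hj' h' hi hjj
    have h1 : a (cell i j hj h) ≤ a (cell i j' hj' (by omega)) := by
      induction j, hjj using Nat.le_induction with
      | base => exact le_rfl
      | succ j hjj ih =>
        exact (H.mono_ne (cell i (j + 1) hj h) (cell i j (by omega) (by omega)) rfl rfl).trans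
          (ih _ _)
    refine h1.trans ?_
    clear h1
    induction i', hi using Nat.le_induction with
    | base => exact le_rfl
    | succ i' hi ih =>
      exact (ih (by omega)).trans (H.mono_se (cell i' j' hj' (by omega)) _ rfl rfl)
  · rintro ⟨h1, h2, h3⟩
    refine ⟨fun c => ?_, fun c => ?_, fun c d hne hse => ?_, fun c d hse hne => ?_⟩
    · obtain ⟨i, j, hj, h, rfl⟩ := exists_cell c
      exact h1 _ _ _ _
    · obtain ⟨i, j, hj, h, rfl⟩ := exists_cell c
      exact h2 _ _ _ _
    · obtain ⟨i, j, hj, h, rfl⟩ := exists_cell c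
      obtain ⟨i', j', hj', h', rfl⟩ := exists_cell d
      simp only [Cell.ne, Cell.se, cell] at hne hse
      exact h3 _ _ _ _ _ _ _ _ (by omega) (by omega)
    · obtain ⟨i, j, hj, h, rfl⟩ := exists_cell c
      obtain ⟨i', j', hj', h', rfl⟩ := exists_cell d
      simp only [Cell.ne, Cell.se, cell] at hne hse
      exact h3 _ _ _ _ _ _ _ _ (by omega) (by omega)

theorem mem_trapezoids {m n k : ℕ} {a : Cell n k → ℕ} :
    a ∈ trapezoids m n k ↔ IsTrapezoid m n k a := by
  simp [trapezoids]

/-- The entries in the last existing column of each row. -/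
def lastCol {n k : ℕ} (hk : 1 ≤ k) (a : Cell n k → ℕ) (i : Fin n) : ℕ :=
  a (cell i (min (k - 1) (n - 1 - i)) (by omega) (by omega))

/-- The entries in the first column. -/
def firstCol {n k : ℕ} (hk : 1 ≤ k) (a : Cell n k → ℕ) (i : Fin n) : ℕ :=
  a (cell i 0 hk (by omega))

theorem pow_numMaxima {R : Type*} [CommRing R] {m n k : ℕ} (hk : 1 ≤ k) (P : R)
    (a : Cell n k → ℕ) :
    P ^ numMaxima m a = ∏ i, if firstCol hk a i = m + (i + 1) then P else 1 := by
  rw [Finset.prod_ite, Finset.prod_const, Finset.prod_const_one, mul_one, numMaxima]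
  congr 1
  refine Finset.card_bij (fun c _ => c.1.1) ?_ ?_ ?_
  · intro c hc
    obtain ⟨i, j, hj, h, rfl⟩ := exists_cell c
    rw [Finset.mem_filter] at hc
    obtain ⟨-, hj', hc⟩ := hc
    obtain rfl : j = 0 := by simpa [Cell.se, cell] using hj'
    rw [Finset.mem_filter]
    exact ⟨Finset.mem_univ _, hc⟩
  · intro c hc d hd hcd
    obtain ⟨i, j, hj, h, rfl⟩ := exists_cell c
    obtain ⟨i', j', hj', h', rfl⟩ := exists_cell d
    rw [Finset.mem_filter] at hc hd
    have h1 := hc.2.1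
    have h2 := hd.2.1
    simp only [Cell.se, cell, Fin.mk.injEq] at h1 h2 hcd
    obtain rfl : j = j' := by omega
    subst hcd
    rfl
  · intro i hi
    rw [Finset.mem_filter] at hi
    exact ⟨cell i 0 hk (by omega), Finset.mem_filter.2 ⟨Finset.mem_univ _, rfl, hi.2⟩, rfl⟩

/-- The rows with zero-based index at most `n - k` are exactly those that reach the leftmost column;
there `lastCol` reads that column. -/
theorem pow_numMinima {R : Type*} [CommRing R] {n k : ℕ} (hk : 1 ≤ k) (hkn : k ≤ n) (Q : R)
    (a : Cell n k → ℕ) :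
    Q ^ numMinima a =
      ∏ i : Fin n, if (i : ℕ) ≤ n - k ∧ lastCol hk a i = 1 then Q else 1 := by
  rw [Finset.prod_ite, Finset.prod_const, Finset.prod_const_one, mul_one, numMinima]
  congr 1
  have hmin : ∀ i : ℕ, i ≤ n - k → min (k - 1) (n - 1 - i) = k - 1 := fun i hi => by omega
  refine Finset.card_bij (fun c _ => c.1.1) ?_ ?_ ?_
  · intro c hc
    obtain ⟨i, j, hj, h, rfl⟩ := exists_cell c
    rw [Finset.mem_filter] at hc
    obtain ⟨-, hj', hc⟩ := hc
    simp only [Cell.se, cell] at hj'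
    obtain rfl : j = k - 1 := by omega
    have hi : i ≤ n - k := by omega
    rw [Finset.mem_filter]
    refine ⟨Finset.mem_univ _, hi, ?_⟩
    refine Eq.trans (congrArg a ?_) hc
    simp only [cell, hmin i hi]
  · intro c hc d hd hcd
    obtain ⟨i, j, hj, h, rfl⟩ := exists_cell c
    obtain ⟨i', j', hj', h', rfl⟩ := exists_cell d
    rw [Finset.mem_filter] at hc hd
    have h1 := hc.2.1
    have h2 := hd.2.1
    simp only [Cell.se, cell, Fin.mk.injEq] at h1 h2 hcd
    obtain rfl : j = j' := by omega
    subst hcd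
    rfl
  · intro i hi
    rw [Finset.mem_filter] at hi
    obtain ⟨-, hi, h1⟩ := hi
    refine ⟨cell i (k - 1) (by omega) (by omega), Finset.mem_filter.2 ⟨Finset.mem_univ _, ?_, ?_⟩,
      rfl⟩
    · simp only [Cell.se, cell]
      omega
    · refine Eq.trans (congrArg a ?_) h1
      simp only [cell, hmin i hi]

/-! ### Adding and removing a column -/

/-- The possible continuations of a column sequence by one more column. -/
def nextCols {n : ℕ} (k : ℕ) (b : Fin n → ℕ) : Finset (Fin n → ℕ) :=
  (Fintype.piFinset fun i => Finset.Icc 1 (b i)).filter fun c =>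
    Monotone c ∧ ∀ i : Fin n, n ≤ i + k → c i = b i

theorem mem_nextCols {n k : ℕ} {b c : Fin n → ℕ} : c ∈ nextCols k b ↔
    (∀ i, 1 ≤ c i) ∧ c ≤ b ∧ Monotone c ∧ ∀ i : Fin n, n ≤ i + k → c i = b i := by
  simp only [nextCols, Finset.mem_filter, Fintype.mem_piFinset, Finset.mem_Icc, forall_and,
    Pi.le_def, and_assoc]

/-- Omission of the last column. -/
def dropCol {n k : ℕ} (a : Cell n (k + 1) → ℕ) : Cell n k → ℕ :=
  fun c => a (cell c.1.1 c.1.2 (by omega) c.2)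

/-- Addition of one more column. -/
def addCol {n k : ℕ} (a : Cell n k → ℕ) (c : Fin n → ℕ) : Cell n (k + 1) → ℕ :=
  fun d => if h : (d.1.2 : ℕ) < k then a (cell d.1.1 d.1.2 h d.2) else c d.1.1

theorem lastCol_mem_nextCols {m n k : ℕ} (hk : 1 ≤ k) {a : Cell n (k + 1) → ℕ}
    (ha : IsTrapezoid m n (k + 1) a) :
    lastCol (Nat.le_add_left 1 k) a ∈ nextCols k (lastCol hk (dropCol a)) := by
  obtain ⟨h1, h2, h3⟩ := isTrapezoid_iff.1 ha
  rw [mem_nextCols]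
  refine ⟨fun i => h1 _ _ _ _, fun i => ?_, fun i j hij => ?_, fun i hi => ?_⟩
  · exact h3 _ _ _ _ _ _ _ _ le_rfl (by simp only [cell]; omega)
  · exact h3 _ _ _ _ _ _ _ _ hij (by have := Fin.le_def.1 hij; omega)
  · simp only [lastCol, dropCol, cell]
    congr 4
    omega

theorem isTrapezoid_dropCol {m n k : ℕ} {a : Cell n (k + 1) → ℕ}
    (ha : IsTrapezoid m n (k + 1) a) : IsTrapezoid m n k (dropCol a) := by
  obtain ⟨h1, h2, h3⟩ := isTrapezoid_iff.1 ha
  exact isTrapezoid_iff.2 ⟨fun i j hj h => h1 i j _ _, fun i j hj h => h2 i j _ _,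
    fun i j hj h i' j' hj' h' hi hjj => h3 i j _ _ i' j' _ _ hi hjj⟩

theorem addCol_of_lt {n k : ℕ} (a : Cell n k → ℕ) (c : Fin n → ℕ) {i j : ℕ} (hj : j < k)
    (h : i + j < n) : addCol a c (cell i j (by omega) h) = a (cell i j hj h) := by
  simp [addCol, cell, hj]

theorem addCol_of_eq {n k : ℕ} (a : Cell n k → ℕ) (c : Fin n → ℕ) {i j : ℕ} (hj : j = k)
    (h : i + j < n) : addCol a c (cell i j (by omega) h) = c ⟨i, by omega⟩ := by
  simp [addCol, cell, hj]

theorem isTrapezoid_addCol {m n k : ℕ} (hk : 1 ≤ k) {a : Cell n k → ℕ}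
    (ha : IsTrapezoid m n k a) {c : Fin n → ℕ} (hc : c ∈ nextCols k (lastCol hk a)) :
    IsTrapezoid m n (k + 1) (addCol a c) := by
  obtain ⟨h1, h2, h3⟩ := isTrapezoid_iff.1 ha
  obtain ⟨c1, c2, c3, c4⟩ := mem_nextCols.1 hc
  have hle : ∀ i (h : i + k < n), c ⟨i, by omega⟩ ≤ a (cell i (k - 1) (by omega) (by omega)) :=
    fun i h => (c2 ⟨i, by omega⟩).trans (h3 _ _ _ _ _ _ _ _ le_rfl (by simp only; omega))
  rw [isTrapezoid_iff]
  refine ⟨fun i j hj h => ?_, fun i j hj h => ?_, fun i j hj h i' j' hj' h' hi hjj => ?_⟩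
  · rcases Nat.lt_succ_iff_lt_or_eq.1 hj with hj | hj
    · rw [addCol_of_lt a c hj]; exact h1 _ _ _ _
    · rw [addCol_of_eq a c hj]; exact c1 _
  · rcases Nat.lt_succ_iff_lt_or_eq.1 hj with hj | hj
    · rw [addCol_of_lt a c hj]; exact h2 _ _ _ _
    · rw [addCol_of_eq a c hj]; exact (hle i (by omega)).trans (h2 _ _ _ _)
  · rcases Nat.lt_succ_iff_lt_or_eq.1 hj with hj | hj
    · rw [addCol_of_lt a c hj, addCol_of_lt a c (by omega)]
      exact h3 _ _ _ _ _ _ _ _ hi hjj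
    · rw [addCol_of_eq a c hj]
      rcases Nat.lt_succ_iff_lt_or_eq.1 hj' with hj' | hj'
      · rw [addCol_of_lt a c hj']
        exact (hle i (by omega)).trans (h3 _ _ _ _ _ _ _ _ hi (by omega))
      · rw [addCol_of_eq a c hj']
        exact c3 (Fin.le_def.2 hi)

theorem lastCol_addCol {n k : ℕ} (hk : 1 ≤ k) {a : Cell n k → ℕ} {c : Fin n → ℕ}
    (hc : c ∈ nextCols k (lastCol hk a)) : lastCol (Nat.le_add_left 1 k) (addCol a c) = c := by
  obtain ⟨-, -, -, c4⟩ := mem_nextCols.1 hc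
  funext i
  rw [lastCol]
  by_cases hi : n ≤ i + k
  · rw [addCol_of_lt a c (by omega), c4 i hi, lastCol]
    congr 2
    omega
  · rw [addCol_of_eq a c (by omega)]

theorem dropCol_addCol {n k : ℕ} (a : Cell n k → ℕ) (c : Fin n → ℕ) :
    dropCol (addCol a c) = a := by
  funext d
  obtain ⟨i, j, hj, h, rfl⟩ := exists_cell d
  exact addCol_of_lt a c hj h

theorem addCol_dropCol {n k : ℕ} (a : Cell n (k + 1) → ℕ) :
    addCol (dropCol a) (lastCol (Nat.le_add_left 1 k) a) = a := by
  funext d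
  obtain ⟨i, j, hj, h, rfl⟩ := exists_cell d
  rcases Nat.lt_succ_iff_lt_or_eq.1 hj with hj | hj
  · rw [addCol_of_lt _ _ hj]; rfl
  · rw [addCol_of_eq _ _ hj, lastCol]
    congr 1
    simp only [cell]
    congr 3
    omega

/-- The maxima depend on the first column only, so removing the last column leaves their weight
unchanged. Allowing an arbitrary function of the last column is what makes an induction on `k`
possible. -/
theorem sum_trapezoids_succ {R : Type*} [CommRing R] (m n k : ℕ) (hk : 1 ≤ k) (P : R)
    (F : (Fin n → ℕ) → R) :
    ∑ a ∈ trapezoids m n (k + 1), P ^ numMaxima m a * F (lastCol (Nat.le_add_left 1 k) a) =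
      ∑ a ∈ trapezoids m n k, P ^ numMaxima m a * ∑ c ∈ nextCols k (lastCol hk a), F c := by
  simp only [Finset.mul_sum]
  rw [Finset.sum_sigma']
  refine Finset.sum_bij'
    (fun a _ => (⟨dropCol a, lastCol (Nat.le_add_left 1 k) a⟩ : (_ : Cell n k → ℕ) × (Fin n → ℕ)))
    (fun p _ => addCol p.1 p.2) ?_ ?_ ?_ ?_ ?_
  · intro a ha
    rw [mem_trapezoids] at ha
    rw [Finset.mem_sigma, mem_trapezoids]
    exact ⟨isTrapezoid_dropCol ha, lastCol_mem_nextCols hk ha⟩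
  · rintro ⟨a, c⟩ h
    rw [Finset.mem_sigma, mem_trapezoids] at h
    rw [mem_trapezoids]
    exact isTrapezoid_addCol hk h.1 h.2
  · intro a _
    exact addCol_dropCol a
  · rintro ⟨a, c⟩ h
    rw [Finset.mem_sigma] at h
    simp only [dropCol_addCol, lastCol_addCol hk h.2]
  · intro a _
    rw [pow_numMaxima (Nat.le_add_left 1 k), pow_numMaxima hk]
    rfl

end Magog

namespace Magog

variable {n : ℕ} {R : Type*} [CommRing R]

/-! ### One-variable series and the weights of the first column -/

/-- All exponents of `g` are at least `N`. -/
def LowerBd (N : ℤ) (g : HahnSeries ℤ R) : Prop := ∀ t, g.coeff t ≠ 0 → N ≤ t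

/-- All exponents of `g` are at most `N`. -/
def UpperBd (N : ℤ) (g : HahnSeries ℤ R) : Prop := ∀ t, g.coeff t ≠ 0 → t ≤ N

theorem LowerBd.mul {N N' : ℤ} {f g : HahnSeries ℤ R} (hf : LowerBd N f) (hg : LowerBd N' g) :
    LowerBd (N + N') (f * g) := by
  intro e he
  obtain ⟨a, ha, b, hb, rfl⟩ := HahnSeries.support_mul_subset ((HahnSeries.mem_support _ _).2 he)
  exact add_le_add (hf a ha) (hg b hb)

theorem UpperBd.mul {N N' : ℤ} {f g : HahnSeries ℤ R} (hf : UpperBd N f) (hg : UpperBd N' g) :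
    UpperBd (N + N') (f * g) := by
  intro e he
  obtain ⟨a, ha, b, hb, rfl⟩ := HahnSeries.support_mul_subset ((HahnSeries.mem_support _ _).2 he)
  exact add_le_add (hf a ha) (hg b hb)

theorem LowerBd.add {N : ℤ} {f g : HahnSeries ℤ R} (hf : LowerBd N f) (hg : LowerBd N g) :
    LowerBd N (f + g) := by
  intro e he
  rw [HahnSeries.coeff_add] at he
  by_cases h : f.coeff e = 0
  · exact hg e (by rwa [h, zero_add] at he)
  · exact hf e h

theorem UpperBd.add {N : ℤ} {f g : HahnSeries ℤ R} (hf : UpperBd N f) (hg : UpperBd N g) :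
    UpperBd N (f + g) := by
  intro e he
  rw [HahnSeries.coeff_add] at he
  by_cases h : f.coeff e = 0
  · exact hg e (by rwa [h, zero_add] at he)
  · exact hf e h

theorem lowerBd_single {N t : ℤ} (h : N ≤ t) (r : R) : LowerBd N (HahnSeries.single t r) := by
  intro e he
  by_contra h'
  exact he (HahnSeries.coeff_single_of_ne (by omega))

theorem upperBd_single {N t : ℤ} (h : t ≤ N) (r : R) : UpperBd N (HahnSeries.single t r) := by
  intro e he
  by_contra h'
  exact he (HahnSeries.coeff_single_of_ne (by omega))

theorem LowerBd.coeff_eq_zero {N : ℤ} {f : HahnSeries ℤ R} (h : LowerBd N f) (hN : 0 < N) :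
    f.coeff 0 = 0 := by
  by_contra h'
  exact absurd (h 0 h') (by omega)

theorem UpperBd.coeff_eq_zero {N : ℤ} {f : HahnSeries ℤ R} (h : UpperBd N f) (hN : N < 0) :
    f.coeff 0 = 0 := by
  by_contra h'
  exact absurd (h 0 h') (by omega)

/-- The negated variable. -/
noncomputable def y₁ (R : Type*) [CommRing R] : (HahnSeries ℤ R)ˣ where
  val := HahnSeries.single 1 (-1)
  inv := HahnSeries.single (-1) (-1)
  val_inv := by rw [HahnSeries.single_mul_single]; simp
  inv_val := by rw [HahnSeries.single_mul_single]; simp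

theorem neg_y₁ : -(y₁ R : HahnSeries ℤ R) = HahnSeries.single 1 1 := by
  ext t
  rw [HahnSeries.coeff_neg, y₁, HahnSeries.coeff_single, HahnSeries.coeff_single]
  split_ifs <;> simp

theorem one_sub_y₁_eq :
    (1 - y₁ R : HahnSeries ℤ R) = HahnSeries.ofPowerSeries ℤ R (1 + PowerSeries.X) := by
  rw [map_add, map_one, HahnSeries.ofPowerSeries_X, sub_eq_add_neg]
  rw [neg_y₁]

theorem isUnit_one_add_X : IsUnit (1 + PowerSeries.X : PowerSeries R) := by
  rw [PowerSeries.isUnit_iff_constantCoeff]; simp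

/-- `1 - y` for the negated variable `y`. -/
noncomputable def z₁ (R : Type*) [CommRing R] : (HahnSeries ℤ R)ˣ :=
  Units.map (HahnSeries.ofPowerSeries ℤ R).toMonoidHom (isUnit_one_add_X (R := R)).unit

theorem coe_z₁ : (z₁ R : HahnSeries ℤ R) = 1 - y₁ R := by
  rw [one_sub_y₁_eq]; rfl

theorem lowerBd_ofPowerSeries (p : PowerSeries R) :
    LowerBd 0 (HahnSeries.ofPowerSeries ℤ R p) := by
  intro t ht
  rw [HahnSeries.ofPowerSeries_apply] at ht
  obtain ⟨d, -, rfl⟩ := HahnSeries.support_embDomain_subset ((HahnSeries.mem_support _ _).2 ht)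
  simp

theorem lowerBd_z₁_zpow (p : ℤ) : LowerBd 0 ((z₁ R ^ p : (HahnSeries ℤ R)ˣ) : HahnSeries ℤ R) := by
  rw [z₁, ← map_zpow]
  exact lowerBd_ofPowerSeries _

theorem coe_y₁_zpow (p : ℤ) : ∃ r : R,
    ((y₁ R ^ p : (HahnSeries ℤ R)ˣ) : HahnSeries ℤ R) = HahnSeries.single p r := by
  have hnat : ∀ p : ℕ, (y₁ R : HahnSeries ℤ R) ^ p = HahnSeries.single (p : ℤ) ((-1) ^ p) := by
    intro p
    rw [y₁, HahnSeries.single_pow]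
    simp
  have hinv : ∀ p : ℕ, (((y₁ R)⁻¹ : (HahnSeries ℤ R)ˣ) : HahnSeries ℤ R) ^ p =
      HahnSeries.single (-(p : ℤ)) ((-1) ^ p) := by
    intro p
    change (HahnSeries.single (-1 : ℤ) (-1 : R)) ^ p = _
    rw [HahnSeries.single_pow]
    simp
  rcases p.eq_nat_or_neg with ⟨q, rfl | rfl⟩
  · exact ⟨_, by rw [zpow_natCast, Units.val_pow_eq_pow_val, hnat]⟩
  · exact ⟨_, by rw [zpow_neg, zpow_natCast, ← inv_pow, Units.val_pow_eq_pow_val, hinv]⟩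

theorem lowerBd_y₁_zpow (p : ℤ) : LowerBd p ((y₁ R ^ p : (HahnSeries ℤ R)ˣ) : HahnSeries ℤ R) := by
  obtain ⟨r, hr⟩ := coe_y₁_zpow (R := R) p
  rw [hr]
  exact lowerBd_single le_rfl r

theorem upperBd_y₁_zpow (p : ℤ) : UpperBd p ((y₁ R ^ p : (HahnSeries ℤ R)ˣ) : HahnSeries ℤ R) := by
  obtain ⟨r, hr⟩ := coe_y₁_zpow (R := R) p
  rw [hr]
  exact upperBd_single le_rfl r

theorem upperBd_z₁_pow (p : ℕ) : UpperBd (p : ℤ) ((z₁ R : HahnSeries ℤ R) ^ p) := by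
  induction p with
  | zero =>
    rw [pow_zero]
    exact upperBd_single le_rfl 1
  | succ p ih =>
    rw [pow_succ, Nat.cast_succ]
    refine ih.mul ?_
    rw [coe_z₁, sub_eq_add_neg, neg_y₁]
    exact UpperBd.add (upperBd_single (by omega) 1) (upperBd_single le_rfl _)

/-- The factor `y + P (1 - y)`. -/
noncomputable def factor (P : R) : HahnSeries ℤ R :=
  (y₁ R : HahnSeries ℤ R) + HahnSeries.C P * (z₁ R : HahnSeries ℤ R)

theorem lowerBd_factor (P : R) : LowerBd 0 (factor P) := by
  refine LowerBd.add (lowerBd_single (by omega) _) ?_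
  have h := lowerBd_z₁_zpow (R := R) 1
  rw [zpow_one] at h
  exact LowerBd.mul (N := 0) (N' := 0) (lowerBd_single le_rfl P) h

theorem upperBd_factor (P : R) : UpperBd 1 (factor P) := by
  refine UpperBd.add (upperBd_single le_rfl _) ?_
  have h := upperBd_z₁_pow (R := R) 1
  rw [pow_one] at h
  exact UpperBd.mul (N := 0) (N' := 1) (upperBd_single le_rfl P) h

/-- The monomial `y ^ p (1 - y) ^ q`. -/
noncomputable def yz (R : Type*) [CommRing R] (p q : ℤ) : HahnSeries ℤ R :=
  ((y₁ R ^ p * z₁ R ^ q : (HahnSeries ℤ R)ˣ) : HahnSeries ℤ R)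

theorem yz_mul (p q p' q' : ℤ) : yz R p q * yz R p' q' = yz R (p + p') (q + q') := by
  rw [yz, yz, yz, ← Units.val_mul, zpow_add, zpow_add, mul_mul_mul_comm]

theorem yz_pow (p q : ℤ) (k : ℕ) : yz R p q ^ k = yz R (p * k) (q * k) := by
  rw [yz, yz, ← Units.val_pow_eq_pow_val, mul_pow, zpow_mul, zpow_mul, zpow_natCast, zpow_natCast]

theorem yz_sub (p q : ℤ) : yz R p q - yz R (p + 1) q = yz R p (q + 1) := by
  simp only [yz, zpow_add_one, Units.val_mul, coe_z₁]
  ring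

theorem lowerBd_yz (p q : ℤ) : LowerBd p (yz R p q) := by
  have := (lowerBd_y₁_zpow (R := R) p).mul (lowerBd_z₁_zpow q)
  rwa [add_zero] at this

theorem upperBd_yz (p : ℤ) (q : ℕ) : UpperBd (p + q) (yz R p q) := by
  rw [yz, zpow_natCast]
  exact (upperBd_y₁_zpow (R := R) p).mul (upperBd_z₁_pow q)

theorem yz_zero : yz R 0 0 = 1 := by simp [yz]

theorem coeff_yz_zero_of_ne {p : ℤ} (hp : p ≠ 0) : (yz R p 0).coeff 0 = 0 := by
  obtain ⟨r, hr⟩ := coe_y₁_zpow (R := R) p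
  rw [yz, zpow_zero, mul_one, hr, HahnSeries.coeff_single_of_ne hp.symm]

/-- The geometric series starting at `y^(-p)` has coefficient one at every exponent from `-p` on. -/
theorem coeff_yz_neg (p : ℕ) : (yz R (-p) (-1)).coeff 0 = 1 := by
  have h : ∀ p : ℤ, yz R p (-1) = yz R p 0 + yz R (p + 1) (-1) := by
    intro p
    rw [← sub_eq_iff_eq_add, yz_sub, neg_add_cancel]
  induction p with
  | zero =>
    rw [h, HahnSeries.coeff_add, (lowerBd_yz (-((0 : ℕ) : ℤ) + 1) _).coeff_eq_zero (by simp)]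
    simp [yz_zero]
  | succ p ih =>
    rw [h, HahnSeries.coeff_add, coeff_yz_zero_of_ne (by push_cast; omega), zero_add, ← ih]
    congr 2
    push_cast
    ring

/-! ### The determinant of a first column -/

/-- The base factor of the alternating form. -/
noncomputable def baseB (m : ℕ) (P : R) : HahnSeries ℤ R := yz R (-(m + 1)) (-1) * factor P

/-- The variable `(1 - y) / y²` of the Vandermonde determinant. -/
noncomputable def baseV (R : Type*) [CommRing R] : HahnSeries ℤ R := yz R (-2) 1

theorem base_mul (m : ℕ) (P : R) (σ : ℕ) (p q : ℤ) :
    baseB m P * baseV R ^ σ * yz R p q = yz R (p - (m + 1) - 2 * σ) (q + σ - 1) * factor P := by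
  have : baseB m P * baseV R ^ σ * yz R p q =
      yz R (-(m + 1)) (-1) * yz R (-2 * σ) (1 * σ) * yz R p q * factor P := by
    rw [baseB, baseV, yz_pow]
    ring
  rw [this, yz_mul, yz_mul]
  congr 2 <;> ring

/-- All exponents are positive. This kills the determinant when an entry exceeds its bound. -/
theorem base_coeff_of_lt (m : ℕ) (P : R) {σ : ℕ} {p : ℤ} (q : ℤ) (h : (m : ℤ) + 1 + 2 * σ < p) :
    (baseB m P * baseV R ^ σ * yz R p q).coeff 0 = 0 := by
  rw [base_mul]
  exact ((lowerBd_yz _ _).mul (lowerBd_factor P)).coeff_eq_zero (by omega)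

/-- For `i < σ` the power of `1 - y` is nonnegative, so the series is a Laurent polynomial, with top
exponent at most `a - (m+1) - σ < 0`. This gives the triangular shape. -/
theorem base_coeff_of_gt (m : ℕ) (P : R) {σ i a : ℕ} (hi : i < σ) (h : a < m + 1 + σ) :
    (baseB m P * baseV R ^ σ * yz R (a + i) (-i)).coeff 0 = 0 := by
  rw [base_mul, show (-(i : ℤ) + σ - 1) = ((σ - i - 1 : ℕ) : ℤ) by omega]
  exact ((upperBd_yz _ _).mul (upperBd_factor P)).coeff_eq_zero (by omega)

/-- With `d = a - (m+1) - i ≤ 0` the series is `P y^d + y^(d+1)/(1-y)`. For `d = 0` only the first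
summand has a constant term, and for `d < 0` only the second. -/
theorem base_coeff_diag (m : ℕ) (P : R) {i a : ℕ} (h : a ≤ m + (i + 1)) :
    (baseB m P * baseV R ^ i * yz R (a + i) (-i)).coeff 0 =
      if a = m + (i + 1) then P else 1 := by
  have h1 : yz R (a + i - (m + 1) - 2 * i) (-i + i - 1) * factor P =
      P • yz R (a - (m + 1) - i) 0 + yz R (a - (m + 1) - i + 1) (-1) := by
    rw [factor, mul_add, ← mul_assoc, mul_comm _ (HahnSeries.C P), mul_assoc,
      HahnSeries.C_mul_eq_smul, add_comm]
    have hz : (z₁ R : HahnSeries ℤ R) = yz R 0 1 := by simp [yz]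
    have hy : (y₁ R : HahnSeries ℤ R) = yz R 1 0 := by simp [yz]
    rw [hz, hy, yz_mul, yz_mul]
    congr 3 <;> ring
  rw [base_mul, h1, HahnSeries.coeff_add, HahnSeries.coeff_smul]
  split_ifs with heq
  · rw [show (a : ℤ) - (m + 1) - i = 0 by omega, yz_zero,
      (lowerBd_yz _ _).coeff_eq_zero (by simp)]
    simp
  · obtain ⟨p, hp⟩ : ∃ p : ℕ, m + i = a + p := ⟨m + i - a, by omega⟩
    rw [coeff_yz_zero_of_ne (by omega), show (a : ℤ) - (m + 1) - i + 1 = -(p : ℤ) by omega,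
      coeff_yz_neg]
    simp

theorem exists_perm_ge {i₀ : Fin n} (π : Equiv.Perm (Fin n)) : ∃ σ ≤ i₀, i₀ ≤ π σ := by
  by_contra! h
  have h1 : (Finset.Iic i₀).card ≤ (Finset.Iio i₀).card :=
    Finset.card_le_card_of_injOn π (fun σ hσ => by simpa using h σ (by simpa using hσ))
      π.injective.injOn
  simp at h1

theorem altForm_firstCol (m : ℕ) (P : R) (a : Fin n → ℕ) (ha : Monotone a) :
    altForm n (baseB m P) (baseV R) (fun i => yz R (a i + i) (-i)) =
      if ∀ i, a i ≤ m + (i + 1) then ∏ i, (if a i = m + (i + 1) then P else 1) else 0 := by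
  rw [altForm_apply, altFun_prod_subst]
  split_ifs with h
  · let M : Matrix (Fin n) (Fin n) R := fun i σ =>
      (baseB m P * baseV R ^ (σ : ℕ) * yz R (a i + i) (-i)).coeff 0
    have hdet : M.det = ∏ i, M i i := by
      refine Matrix.det_of_isLowerTriangular M fun i σ hiσ => ?_
      have hlt : i < σ := OrderDual.toDual_lt_toDual.1 hiσ
      exact base_coeff_of_gt m P (Fin.lt_def.1 hlt)
        (lt_of_le_of_lt (h i) (by have := Fin.lt_def.1 hlt; omega))
    have hM : M.det = ∑ π : Equiv.Perm (Fin n), (Equiv.Perm.sign π : ℤ) •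
      ∏ i : Fin n, (baseB m P * baseV R ^ (i : ℕ) *
        yz R (a (π i) + (π i : ℕ)) (-(π i : ℕ))).coeff 0 := by
      rw [Matrix.det_apply]
      rfl
    rw [← hM, hdet]
    exact Finset.prod_congr rfl fun i _ => base_coeff_diag m P (h i)
  · push Not at h
    obtain ⟨i₀, hi₀⟩ := h
    refine Finset.sum_eq_zero fun π _ => ?_
    -- A permutation cannot map the indices up to `i₀` into those below `i₀`. Hence every Leibniz
    -- term contains an entry with row at least `i₀` and column at most `i₀`, which vanishes.
    obtain ⟨σ, h1, h2⟩ := exists_perm_ge (i₀ := i₀) π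
    rw [Finset.prod_eq_zero (Finset.mem_univ σ), smul_zero]
    refine base_coeff_of_lt m P _ ?_
    have := ha h2
    have := Fin.le_def.1 h1
    have := Fin.le_def.1 h2
    omega

/-! ### The generating function as a sum over heights -/

/-- Weakly increasing sequences with values between `1` and `M`. -/
def monoBox (n M : ℕ) : Finset (Fin n → ℕ) :=
  (Fintype.piFinset fun _ => Finset.Icc 1 M).filter Monotone

theorem mem_monoBox {M : ℕ} {b : Fin n → ℕ} :
    b ∈ monoBox n M ↔ (∀ i, 1 ≤ b i) ∧ (∀ i, b i ≤ M) ∧ Monotone b := by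
  simp only [monoBox, Finset.mem_filter, Fintype.mem_piFinset, Finset.mem_Icc, forall_and,
    and_assoc]

/-- The one-variable series that represents the entry `a` of row `i` after `k` columns. -/
noncomputable def sym (R : Type*) [CommRing R] (k : ℕ) (i : Fin n) (a : ℕ) : HahnSeries ℤ R :=
  yz R (a + i) (-((i + min (k - 1) (n - 1 - i) : ℕ) : ℤ))

/-- The box contains every admissible column, and its other sequences contribute zero, so the row
bounds can be dropped from the index set. -/
theorem sum_trapezoids_one (m M : ℕ) (hM : m + n ≤ M) (P : R)
    (F : (Fin n → ℕ) → R) :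
    ∑ a ∈ trapezoids m n 1, P ^ numMaxima m a * F (lastCol le_rfl a) =
      ∑ b ∈ monoBox n M,
        F b * altForm n (baseB m P) (baseV R) (fun i => sym R 1 i (b i)) := by
  have hsym : ∀ b ∈ monoBox n M,
      F b * altForm n (baseB m P) (baseV R) (fun i => sym R 1 i (b i)) =
      if ∀ i : Fin n, b i ≤ m + (i + 1) then
        (∏ i : Fin n, (if b i = m + (i + 1) then P else 1)) * F b else 0 := by
    intro b hb
    have h := altForm_firstCol m P b (mem_monoBox.1 hb).2.2
    have h' : (fun i : Fin n => sym R 1 i (b i)) = fun i : Fin n => yz R (b i + i) (-i) := by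
      funext i
      simp [sym]
    rw [h', h]
    split_ifs
    · rw [mul_comm]
    · rw [mul_zero]
  rw [Finset.sum_congr rfl hsym, ← Finset.sum_filter]
  have hcol : ∀ a : Cell n 1 → ℕ, ∀ i j hj h, j = 0 → lastCol le_rfl a i = a (cell i j hj h) := by
    rintro a i j hj h rfl
    simp [lastCol]
  refine Finset.sum_bij' (fun a _ => lastCol le_rfl a) (fun b _ c => b c.1.1) ?_ ?_ ?_ ?_ ?_
  · intro a ha
    obtain ⟨h1, h2, h3⟩ := isTrapezoid_iff.1 (mem_trapezoids.1 ha)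
    have h4 : ∀ i : Fin n, lastCol le_rfl a i ≤ m + (i + 1) := fun i => h2 _ _ _ _
    rw [Finset.mem_filter, mem_monoBox]
    refine ⟨⟨fun i => h1 _ _ _ _, fun i => (h4 i).trans (by omega), fun i j hij => ?_⟩, h4⟩
    exact h3 _ _ _ _ _ _ _ _ hij (by simp)
  · intro b hb
    rw [Finset.mem_filter, mem_monoBox] at hb
    rw [mem_trapezoids, isTrapezoid_iff]
    exact ⟨fun i j hj h => hb.1.1 _, fun i j hj h => hb.2 _,
      fun i j hj h i' j' hj' h' hi _ => hb.1.2.2 (Fin.le_def.2 hi)⟩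
  · intro a _
    funext c
    obtain ⟨i, j, hj, h, rfl⟩ := exists_cell c
    exact hcol a _ _ _ _ (by omega)
  · intro b _
    rfl
  · intro a _
    rw [pow_numMaxima le_rfl]
    congr 1

theorem sym_eq_sub {k : ℕ} (hk : 1 ≤ k) {i : Fin n} (hi : (i : ℕ) < n - k) (a : ℕ) :
    sym R k i a = sym R (k + 1) i a - sym R (k + 1) i (a + 1) := by
  have h1 : ((i + min (k + 1 - 1) (n - 1 - i) : ℕ) : ℤ) =
      ((i + min (k - 1) (n - 1 - i) : ℕ) : ℤ) + 1 := by omega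
  simp only [sym, h1]
  rw [show ((a + 1 : ℕ) : ℤ) + (i : ℕ) = (a + (i : ℕ)) + 1 by push_cast; ring, yz_sub]
  congr 1
  ring

/-- This coincidence between neighbouring rows is what makes the boundary terms of the telescoping
sum vanish. -/
theorem sym_succ {k : ℕ} (hk : 1 ≤ k) {i j : Fin n} (hij : (j : ℕ) = i + 1)
    (a : ℕ) : sym R k j a = sym R (k + 1) i (a + 1) := by
  simp only [sym]
  congr 1
  · push_cast [hij]; ring
  · congr 2
    omega

theorem sum_between_sym (b v : HahnSeries ℤ R) {k : ℕ} (hk : 1 ≤ k) (hkn : k + 1 ≤ n)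
    {c : Fin n → ℕ} (hc : Monotone c) (hc1 : ∀ i, 1 ≤ c i) :
    ∑ a ∈ between (n - k) c, altForm n b v (fun i => sym R k i (a i)) =
      altForm n b v (fun i => sym R (k + 1) i (c i)) := by
  rw [sum_between (altForm n b v) (sym R k) (sym R (k + 1)) (n - k) (by omega) ?_ ?_ c hc hc1]
  · congr 1
    funext i
    split_ifs with h
    · rfl
    · simp only [sym]
      congr 4
      omega
  · exact fun i hi a _ => sym_eq_sub hk hi a
  · exact fun i j hij _ a _ => ⟨1, by rw [one_smul, sym_succ hk hij]⟩

theorem sum_trapezoids_eq (m M : ℕ) (hM : m + n ≤ M) (P : R) {k : ℕ} (hk : 1 ≤ k)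
    (hkn : k ≤ n) (F : (Fin n → ℕ) → R) :
    ∑ a ∈ trapezoids m n k, P ^ numMaxima m a * F (lastCol hk a) =
      ∑ b ∈ monoBox n M,
        F b * altForm n (baseB m P) (baseV R) (fun i => sym R k i (b i)) := by
  induction k, hk using Nat.le_induction generalizing F with
  | base => exact sum_trapezoids_one m M hM P F
  | succ k hk ih =>
    rw [sum_trapezoids_succ m n k hk P F,
      ih (by omega) (fun b => ∑ c ∈ nextCols k b, F c)]
    simp only [Finset.sum_mul]
    -- Exchange the order of summation: for a fixed new column `c`, the old columns are those
    -- between `c` and its fixed part. The rows from `n - k` on have no new entry.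
    rw [Finset.sum_comm' (t' := monoBox n M) (s' := fun c => between (n - k) c)]
    · refine Finset.sum_congr rfl fun c hc => ?_
      rw [← Finset.mul_sum, sum_between_sym _ _ hk hkn (mem_monoBox.1 hc).2.2
        (mem_monoBox.1 hc).1]
    · intro b c
      rw [mem_monoBox, mem_monoBox, mem_nextCols, mem_between (by omega)]
      constructor
      · rintro ⟨⟨-, h2, h3⟩, h4, h5, h6, h7⟩
        exact ⟨⟨h5, h3, fun i hi => (h7 i (by omega)).symm⟩, h4, fun i => (h5 i).trans (h2 i), h6⟩
      · rintro ⟨⟨h1, h2, h3⟩, h4, h5, h6⟩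
        refine ⟨⟨fun i => (h4 i).trans (h1 i), fun i => ?_, h2⟩, h4, h1, h6,
          fun i hi => (h3 i (by omega)).symm⟩
        have hl : b i ≤ b ⟨n - 1, by omega⟩ := h2 (Fin.le_def.2 (by simp; omega))
        rw [h3 ⟨n - 1, by omega⟩ (by simp; omega)] at hl
        exact hl.trans (h5 _)

/-- Sequences are grouped by their entries from `s` on. Below `s` they are constrained only by
positivity and monotonicity, which is expressed by the lower bound `1`. -/
theorem sum_monoBox_eq {M : Type*} [AddCommMonoid M] {s B : ℕ} (hs : s < n)
    (f : (Fin n → ℕ) → M) :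
    ∑ b ∈ monoBox n B, f b =
      ∑ c ∈ (monoBox n B).filter (fun c => ∀ i : Fin n, (i : ℕ) < s → c i = 1),
        ∑ b ∈ between s c, f b := by
  let g : (Fin n → ℕ) → Fin n → ℕ := fun b i => if (i : ℕ) < s then 1 else b i
  rw [← Finset.sum_fiberwise_of_maps_to (g := g)
    (t := (monoBox n B).filter (fun c => ∀ i : Fin n, (i : ℕ) < s → c i = 1))]
  · refine Finset.sum_congr rfl fun c hc => Finset.sum_congr ?_ fun _ _ => rfl
    rw [Finset.mem_filter, mem_monoBox] at hc
    obtain ⟨⟨h1, h2, h3⟩, h4⟩ := hc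
    ext b
    rw [Finset.mem_filter, mem_monoBox, mem_between hs]
    constructor
    · rintro ⟨⟨b1, b2, b3⟩, rfl⟩
      refine ⟨fun i => ?_, b3, fun i hi => ?_⟩
      · simp only [g]
        split_ifs
        · exact b1 i
        · exact le_rfl
      · simp only [g]
        rw [if_neg (by omega)]
    · rintro ⟨b1, b2, b3⟩
      refine ⟨⟨fun i => (h1 i).trans (b1 i), fun i => ?_, b2⟩, funext fun i => ?_⟩
      · have hl : b i ≤ b ⟨n - 1, by omega⟩ := b2 (Fin.le_def.2 (by simp; omega))
        rw [b3 ⟨n - 1, by omega⟩ (by simp; omega)] at hl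
        exact hl.trans (h2 _)
      · simp only [g]
        split_ifs with hi
        · exact (h4 i hi).symm
        · exact b3 i (by omega)
  · intro b hb
    obtain ⟨b1, b2, b3⟩ := mem_monoBox.1 hb
    rw [Finset.mem_filter, mem_monoBox]
    refine ⟨⟨fun i => ?_, fun i => ?_, fun i j hij => ?_⟩, fun i hi => if_pos hi⟩
    · simp only [g]; split_ifs
      · exact le_rfl
      · exact b1 i
    · simp only [g]; split_ifs
      · exact (b1 i).trans (b2 i)
      · exact b2 i
    · have := Fin.le_def.1 hij
      simp only [g]
      split_ifs
      · exact le_rfl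
      · exact b1 j
      · omega
      · exact b3 hij

theorem sum_monoBox_filter {M : Type*} [AddCommMonoid M] {s : ℕ} (hs : s < n) (B : ℕ)
    (f : (Fin n → ℕ) → M) :
    ∑ c ∈ (monoBox n B).filter (fun c => ∀ i : Fin n, (i : ℕ) < s → c i = 1), f c =
      ∑ h ∈ heights n s B, f (fun i => h i + 1) := by
  symm
  refine Finset.sum_nbij' (fun h i => h i + 1) (fun c i => c i - 1) ?_ ?_ ?_ ?_ (fun _ _ => rfl)
  · intro h hh
    obtain ⟨h1, h2, h3⟩ := mem_heights.1 hh
    have hB := h2 ⟨s, hs⟩ le_rfl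
    rw [Finset.mem_filter, mem_monoBox]
    refine ⟨⟨fun i => by omega, fun i => ?_, fun i j hij => ?_⟩, fun i hi => by simp [h1 i hi]⟩
    · rcases lt_or_ge (i : ℕ) s with hi | hi
      · rw [h1 i hi]; omega
      · have := h2 i hi
        omega
    · rcases lt_or_ge (i : ℕ) s with hi | hi
      · simp [h1 i hi]
      · have := h3 i j hi hij
        simpa using this
  · intro c hc
    rw [Finset.mem_filter, mem_monoBox] at hc
    obtain ⟨⟨h1, h2, h3⟩, h4⟩ := hc
    rw [mem_heights]
    refine ⟨fun i hi => by rw [h4 i hi], fun i hi => ?_, fun i j hi hij => ?_⟩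
    · have := h1 i
      have := h2 i
      omega
    · have := h3 hij
      omega
  · intro h _
    funext i
    simp
  · intro c hc
    rw [Finset.mem_filter, mem_monoBox] at hc
    funext i
    exact Nat.sub_add_cancel (hc.1.1 i)

theorem lastCol_weight (b v : HahnSeries ℤ R) {k : ℕ} (hk : 1 ≤ k) (hkn : k ≤ n) (Q : R)
    {c : Fin n → ℕ} (hc : Monotone c) (hc1 : ∀ i, 1 ≤ c i)
    (hcs : ∀ i : Fin n, (i : ℕ) < n - k → c i = 1) :
    ∑ a ∈ between (n - k) c, (∏ i : Fin n, if (i : ℕ) ≤ n - k ∧ a i = 1 then Q else 1) *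
        altForm n b v (fun i => sym R k i (a i)) =
      (if c ⟨n - k, by omega⟩ = 1 then Q else 1) * altForm n b v (fun i =>
        if (i : ℕ) < n - k then yz R (i + 1) (-(i + k)) * factor Q
        else yz R (c i + i) (-(n - 1))) := by
  let w : Fin n → ℕ → R := fun i a => if (i : ℕ) ≤ n - k ∧ a = 1 then Q else 1
  -- The value at `1` is adjusted so that `G i 1 - G i 2` is `Q` times the symbol of the entry `1`;
  -- later differences are unweighted. Summation in the free rows starts at `1`, so this adjusted
  -- value is what remains and produces `factor Q`.
  let G : Fin n → ℕ → HahnSeries ℤ R := fun i a =>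
    if a = 1 then Q • sym R k i 1 + sym R (k + 1) i 2 else sym R (k + 1) i a
  have hG : ∀ i : Fin n, ∀ a, 1 ≤ a → G i (a + 1) = sym R (k + 1) i (a + 1) :=
    fun i a ha => if_neg (by omega)
  have hsmul : ∀ (u : Fin n → R) (g : Fin n → HahnSeries ℤ R),
      altForm n b v (fun i => u i • g i) = (∏ i, u i) • altForm n b v g :=
    (altForm n b v).toMultilinearMap.map_smul_univ
  have hterm : ∀ a : Fin n → ℕ, (∏ i : Fin n, if (i : ℕ) ≤ n - k ∧ a i = 1 then Q else 1) *
      altForm n b v (fun i => sym R k i (a i)) =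
      altForm n b v (fun i => w i (a i) • sym R k i (a i)) := by
    intro a
    rw [hsmul, smul_eq_mul]
  rw [Finset.sum_congr rfl fun a _ => hterm a,
    sum_between (altForm n b v) (fun i a => w i a • sym R k i a) G (n - k) (by omega) ?_ ?_ c hc hc1]
  · have hprod : (∏ i : Fin n, if (i : ℕ) = n - k ∧ c i = 1 then Q else 1) =
        if c ⟨n - k, by omega⟩ = 1 then Q else 1 := by
      rw [Finset.prod_eq_single ⟨n - k, by omega⟩]
      · simp
      · intro i _ hi
        rw [if_neg]
        rintro ⟨h, -⟩
        exact hi (Fin.ext h)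
      · simp
    rw [← hprod, ← smul_eq_mul, ← hsmul]
    congr 1
    funext i
    by_cases hi : (i : ℕ) < n - k
    · simp only [hi, if_true, G, hcs i hi]
      rw [if_neg (by omega), one_smul, factor, mul_add, mul_left_comm, HahnSeries.C_mul_eq_smul,
        add_comm]
      have hz : (z₁ R : HahnSeries ℤ R) = yz R 0 1 := by simp [yz]
      have hy : (y₁ R : HahnSeries ℤ R) = yz R 1 0 := by simp [yz]
      have e1 : sym R k i 1 = yz R (i + 1 + 0) (-(i + k) + 1) := by
        simp only [sym]
        congr 1 <;> omega
      have e2 : sym R (k + 1) i 2 = yz R (i + 1 + 1) (-(i + k) + 0) := by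
        simp only [sym]
        congr 1 <;> omega
      rw [hz, hy, yz_mul, yz_mul, e1, e2]
    · simp only [hi, if_false, w]
      congr 1
      · congr 1
        simp only [eq_iff_iff, and_congr_left_iff]
        intro
        omega
      · simp only [sym]
        congr 1
        omega
  · intro i hi a ha
    simp only [w]
    rw [hG i a ha]
    by_cases h1 : a = 1
    · subst h1
      rw [if_pos ⟨by omega, rfl⟩]
      simp [G]
    · rw [if_neg (by tauto), one_smul, sym_eq_sub hk hi]
      simp only [G, h1, if_false]
  · intro i j hij _ a ha
    exact ⟨w j a, by rw [hG i a ha, sym_succ hk hij]⟩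

theorem genFun_eq_sum_heights (m M : ℕ) (hM : m + n ≤ M) {k : ℕ} (hk : 1 ≤ k) (hkn : k ≤ n)
    (P Q : R) :
    genFun m n k P Q = ∑ h ∈ heights n (n - k) M,
      (if h ⟨n - k, by omega⟩ = 0 then Q else 1) * altForm n (baseB m P) (baseV R) (fun i =>
        if (i : ℕ) < n - k then yz R (i + 1) (-(i + k)) * factor Q
        else yz R (h i + 1 + i) (-(n - 1))) := by
  rw [genFun, Finset.sum_congr rfl fun a _ => by rw [pow_numMinima hk hkn],
    sum_trapezoids_eq m M hM P hk hkn
      (fun b => ∏ i : Fin n, if (i : ℕ) ≤ n - k ∧ b i = 1 then Q else 1),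
    sum_monoBox_eq (s := n - k) (by omega)]
  refine Eq.trans (Finset.sum_congr rfl fun c hc => ?_) (Eq.trans
    (sum_monoBox_filter (s := n - k) (by omega) M fun c =>
      (if c ⟨n - k, by omega⟩ = 1 then Q else 1) * altForm n (baseB m P) (baseV R) (fun i =>
        if (i : ℕ) < n - k then yz R (i + 1) (-(i + k)) * factor Q
        else yz R (c i + i) (-(n - 1)))) ?_)
  · rw [Finset.mem_filter, mem_monoBox] at hc
    exact lastCol_weight _ _ hk hkn Q hc.1.2.2 hc.1.1 hc.2
  · refine Finset.sum_congr rfl fun h _ => ?_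
    simp

/-! ### The constant term expression -/

theorem prod_pairs {M : Type*} [CommMonoid M] (f : Fin n → M) :
    ∏ i, ∏ j ∈ Finset.Ioi i, (f i * f j) = ∏ i, f i ^ (n - 1) := by
  have h : ∏ i : Fin n, ∏ j ∈ Finset.Ioi i, f j = ∏ j : Fin n, f j ^ (j : ℕ) := by
    rw [Finset.prod_comm' (t' := Finset.univ) (s' := fun j => Finset.Iio j) (by simp)]
    refine Finset.prod_congr rfl fun j _ => ?_
    rw [Finset.prod_const, Fin.card_Iio]
  simp only [Finset.prod_mul_distrib, Finset.prod_const, Fin.card_Ioi]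
  rw [h, ← Finset.prod_mul_distrib]
  refine Finset.prod_congr rfl fun i _ => ?_
  rw [← pow_add]
  congr 1
  omega

theorem coe_subst_yz (i : Fin n) (p q : ℤ) :
    (((x R i) ^ p * onePlusX R i ^ q : (Laurent n R)ˣ) : Laurent n R) =
      (((-1 : (Laurent n R)ˣ) ^ p : (Laurent n R)ˣ) : Laurent n R) * subst i (yz R p q) := by
  have hy : Units.map (subst i).toMonoidHom (y₁ R) = -1 * x R i := by
    ext1
    rw [neg_one_mul]
    have h : (y₁ R : HahnSeries ℤ R) = -HahnSeries.single 1 1 := by rw [← neg_y₁, neg_neg]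
    change subst i (y₁ R : HahnSeries ℤ R) = -(x R i : Laurent n R)
    rw [h, ← yv_eq_subst, yv]
  have hz : Units.map (subst i).toMonoidHom (z₁ R) = onePlusX R i := by
    ext1
    have h := congrArg (fun u : (Laurent n R)ˣ => (u : Laurent n R)) hy
    change subst i (y₁ R : HahnSeries ℤ R) = _ at h
    change subst i (z₁ R : HahnSeries ℤ R) = _
    rw [coe_z₁, map_sub, map_one, h, coe_onePlusX, yv]
    simp
  have h : subst i (yz R p q) = (((-1 * x R i) ^ p * onePlusX R i ^ q : (Laurent n R)ˣ) :
      Laurent n R) := by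
    rw [← hy, ← hz, ← map_zpow, ← map_zpow, ← map_mul]
    rfl
  rw [h, ← Units.val_mul, ← mul_assoc, mul_zpow, ← mul_assoc, ← mul_zpow]
  simp

theorem yv_eq_subst_yz (i : Fin n) : yv R i = subst i (yz R 1 0) := by
  have h := coe_subst_yz (R := R) i 1 0
  rw [zpow_zero, mul_one, zpow_one, zpow_one] at h
  rw [yv, h]
  simp

theorem x_sub_C_mul (i : Fin n) (P : R) :
    (x R i : Laurent n R) - HahnSeries.C P * (1 + (x R i : Laurent n R)) =
      -subst i (factor P) := by
  have h1 := yv_eq_subst_yz (R := R) i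
  have h2 : (y₁ R : HahnSeries ℤ R) = yz R 1 0 := by simp [yz]
  rw [factor, coe_z₁, h2, map_add, map_mul, map_sub, map_one, ← h1, subst_C, yv]
  ring

theorem inv_onePlusX_eq (i : Fin n) :
    (((onePlusX R i)⁻¹ : (Laurent n R)ˣ) : Laurent n R) = subst i (yz R 0 (-1)) := by
  have h := coe_subst_yz (R := R) i 0 (-1)
  simpa using h

/-- Since `v = (1 + x)/x²`, each factor is `x_i² x_j² (v(x_j) - v(x_i))`, and each variable lies in
`n - 1` pairs. -/
theorem prod_sub_eq_alternant :
    ∏ i : Fin n, ∏ j ∈ Finset.Ioi i, (((x R i : Laurent n R) - (x R j : Laurent n R)) *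
      ((x R i : Laurent n R) + (x R j : Laurent n R) +
        (x R i : Laurent n R) * (x R j : Laurent n R))) =
      (∏ i : Fin n, ((x R i ^ (2 * ((n - 1 : ℕ) : ℤ)) : (Laurent n R)ˣ) : Laurent n R)) *
        alternant n (baseV R) := by
  have hpow : ∀ i : Fin n, ((x R i ^ (2 * ((n - 1 : ℕ) : ℤ)) : (Laurent n R)ˣ) : Laurent n R) =
      ((x R i : Laurent n R) ^ 2) ^ (n - 1) := by
    intro i
    rw [zpow_mul, zpow_natCast, zpow_ofNat, Units.val_pow_eq_pow_val, Units.val_pow_eq_pow_val]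
  have hv : ∀ i : Fin n, (x R i : Laurent n R) ^ 2 * subst i (baseV R) = 1 + x R i := by
    intro i
    have h := coe_subst_yz (R := R) i (-2) 1
    have h1 : (((-1 : (Laurent n R)ˣ) ^ (-2 : ℤ) : (Laurent n R)ˣ) : Laurent n R) = 1 := by
      rw [Even.neg_one_zpow (by decide), Units.val_one]
    rw [h1, one_mul] at h
    rw [baseV, ← h, ← Units.val_pow_eq_pow_val, ← Units.val_mul, ← mul_assoc, zpow_one,
      zpow_neg, zpow_ofNat, mul_inv_cancel, one_mul, coe_onePlusX, yv, sub_neg_eq_add]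
  simp only [hpow]
  rw [← prod_pairs, alternant, ← Finset.prod_mul_distrib]
  refine Finset.prod_congr rfl fun i _ => ?_
  rw [← Finset.prod_mul_distrib]
  refine Finset.prod_congr rfl fun j _ => ?_
  linear_combination (x R j : Laurent n R) ^ 2 * hv i - (x R i : Laurent n R) ^ 2 * hv j

/-- Multiplying by the block variables clears the inverses `x_j⁻¹`. The `k` signs so produced cancel
`(-1)^k`, leaving the bracket from `sum_heights_weighted`. -/
theorem correction_mul (k : ℕ) (hk : 1 ≤ k) (hkn : k ≤ n) (Q : R) :
    correction k hk hkn Q * mon R (n - k) (fun _ : Fin n => 1) =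
      Q • pivot R (show n - k < n by omega) + mon R (n - k) (fun _ : Fin n => 1) := by
  have hs : n - k < n := by omega
  have hfil : (Finset.univ.filter fun j : Fin n => (n : ℤ) - k + 2 ≤ idx j) =
      blk n (n - k + 1) := by
    ext j
    rw [Finset.mem_filter, mem_blk]
    simp only [Finset.mem_univ, true_and, idx]
    omega
  set s : Fin n := ⟨n - k, hs⟩ with hsdef
  have hinv : ∀ j : Fin n, yv R j * (((x R j)⁻¹ : (Laurent n R)ˣ) : Laurent n R) = -1 := by
    intro j
    rw [yv, neg_mul, Units.mul_inv]
  have hprod : (∏ j ∈ blk n (n - k + 1), yv R j) * (∏ j ∈ blk n (n - k + 1),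
      ((((x R j)⁻¹ : (Laurent n R)ˣ) : Laurent n R) - (x R s : Laurent n R))) =
      (-1) ^ (k - 1) * ∏ j ∈ blk n (n - k + 1), (1 - yv R s * yv R j) := by
    have hcard : (blk n (n - k + 1)).card = k - 1 := by
      by_cases h : n - k + 1 < n
      · rw [← Ioi_eq_blk hs, Fin.card_Ioi]
        simp only
        omega
      · have : blk n (n - k + 1) = ∅ := by
          ext j
          simp only [mem_blk, Finset.notMem_empty, iff_false]
          omega
        rw [this, Finset.card_empty]
        omega
    rw [← Finset.prod_mul_distrib, ← hcard, ← Finset.prod_const, ← Finset.prod_mul_distrib]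
    refine Finset.prod_congr rfl fun j _ => ?_
    have hx : (x R s : Laurent n R) = -yv R s := by rw [yv, neg_neg]
    rw [mul_sub, hinv, hx]
    ring
  have hmon : mon R (n - k) (fun _ : Fin n => 1) = yv R s * ∏ j ∈ blk n (n - k + 1), yv R j := by
    rw [mon_eq_mul hs, mon]
    simp [hsdef]
  have hkk : (-1 : Laurent n R) ^ k = -(-1) ^ (k - 1) := by
    obtain ⟨l, rfl⟩ : ∃ l, k = l + 1 := ⟨k - 1, by omega⟩
    rw [Nat.add_sub_cancel, pow_succ, mul_neg_one]
  have hsq : (-1 : Laurent n R) ^ (k - 1) * (-1) ^ (k - 1) = 1 := by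
    rw [← mul_pow]; simp
  rw [correction, hfil, ← HahnSeries.C_mul_eq_smul, pivot, hmon, hkk]
  simp only [← hsdef]
  have h1 := hinv s
  generalize (∏ j ∈ blk n (n - k + 1), yv R j) = A at *
  generalize (∏ j ∈ blk n (n - k + 1),
      ((((x R j)⁻¹ : (Laurent n R)ˣ) : Laurent n R) - (x R s : Laurent n R))) = B at *
  generalize (∏ j ∈ blk n (n - k + 1), (1 - yv R s * yv R j)) = D at *
  generalize ((-1 : Laurent n R) ^ (k - 1)) = e at *
  linear_combination (-e * HahnSeries.C Q * A * B) * h1 +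
    (-e * HahnSeries.C Q * (yv R s - 1)) * hprod + (-HahnSeries.C Q * (yv R s - 1) * D) * hsq

/-- The indices that are less than `s`. -/
def low (n s : ℕ) : Finset (Fin n) := Finset.univ.filter fun i => (i : ℕ) < s

theorem prod_low_mul_prod_blk {M : Type*} [CommMonoid M] (s : ℕ) (f : Fin n → M) :
    (∏ i ∈ low n s, f i) * ∏ i ∈ blk n s, f i = ∏ i, f i := by
  rw [← Finset.prod_filter_mul_prod_filter_not Finset.univ (fun i : Fin n => (i : ℕ) < s)]
  simp only [low, blk, not_lt]

/-- The rows that do not belong to the block, and the common factor of the rows of the block. -/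
noncomputable def rowFactor (n k : ℕ) (Q : R) : Laurent n R :=
  (∏ i ∈ low n (n - k), subst i (yz R (i + 1) (-(i + k)) * factor Q)) *
    ∏ i ∈ blk n (n - k), subst i (yz R (1 + (n - k : ℕ)) (-(n - 1)))

theorem low_factor (m k : ℕ) (i : Fin n) (P Q : R) :
    ((onePlusX R i ^ (-idx i - k) : (Laurent n R)ˣ) : Laurent n R) *
      ((x R i ^ (-(m : ℤ) - 2 * n + idx i + 1) : (Laurent n R)ˣ) : Laurent n R) *
      ((x R i : Laurent n R) - HahnSeries.C P * (1 + (x R i : Laurent n R))) *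
      ((x R i : Laurent n R) - HahnSeries.C Q * (1 + (x R i : Laurent n R))) *
      ((x R i ^ (2 * ((n - 1 : ℕ) : ℤ)) : (Laurent n R)ˣ) : Laurent n R) =
    (((-1 : (Laurent n R)ˣ) ^ ((i : ℤ) - m) : (Laurent n R)ˣ) : Laurent n R) *
      (subst i (baseB m P) * subst i (yz R (i + 1) (-(i + k)) * factor Q)) := by
  have hi := i.2
  have h := coe_subst_yz (R := R) i (i - m) (-(i + 1) - k)
  have h1 : (x R i ^ ((i : ℤ) - m) * onePlusX R i ^ (-((i : ℤ) + 1) - k) : (Laurent n R)ˣ) =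
      onePlusX R i ^ (-idx i - k) * x R i ^ (-(m : ℤ) - 2 * n + idx i + 1) *
        x R i ^ (2 * ((n - 1 : ℕ) : ℤ)) := by
    rw [mul_assoc, ← zpow_add, mul_comm, idx]
    congr 2
    omega
  have h2 : yz R (i - m) (-(i + 1) - k) = yz R (-(m + 1)) (-1) * yz R (i + 1) (-(i + k)) := by
    rw [yz_mul]
    congr 1 <;> ring
  rw [h1, h2] at h
  simp only [Units.val_mul, map_mul] at h
  rw [x_sub_C_mul, x_sub_C_mul, baseB, map_mul, map_mul]
  linear_combination subst i (factor P) * subst i (factor Q) * h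

/-- Besides the base factor and the sign, the power splits into a part that is the same in all rows
of the block, the staircase, the denominator `1 - y_i` of the symmetric series, and one `y_i`
reserved for the correction factor. -/
theorem blk_factor (m s : ℕ) (i : Fin n) (hsi : s ≤ (i : ℕ)) (P : R) :
    ((onePlusX R i ^ (-(n : ℤ) - 1) : (Laurent n R)ˣ) : Laurent n R) *
      ((x R i ^ (-(m : ℤ) - 2 * n + idx i + 2) : (Laurent n R)ˣ) : Laurent n R) *
      ((x R i : Laurent n R) - HahnSeries.C P * (1 + (x R i : Laurent n R))) *
      ((x R i ^ (2 * ((n - 1 : ℕ) : ℤ)) : (Laurent n R)ˣ) : Laurent n R) =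
    (((-1 : (Laurent n R)ˣ) ^ ((i : ℤ) - m) : (Laurent n R)ˣ) : Laurent n R) *
      (subst i (baseB m P) * (subst i (yz R (1 + (s : ℕ)) (-(n - 1))) *
        yv R i ^ ((i : ℕ) - s) * (((onePlusX R i)⁻¹ : (Laurent n R)ˣ) : Laurent n R) *
        yv R i ^ 1)) := by
  have hi := i.2
  have h := coe_subst_yz (R := R) i (i - m + 1) (-n - 1)
  have h1 : (x R i ^ ((i : ℤ) - m + 1) * onePlusX R i ^ (-(n : ℤ) - 1) : (Laurent n R)ˣ) =
      onePlusX R i ^ (-(n : ℤ) - 1) * x R i ^ (-(m : ℤ) - 2 * n + idx i + 2) *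
        x R i ^ (2 * ((n - 1 : ℕ) : ℤ)) := by
    rw [mul_assoc, ← zpow_add, mul_comm, idx]
    congr 2
    omega
  have h2 : yz R (i - m + 1) (-n - 1) = yz R (-(m + 1)) (-1) * (yz R (1 + (s : ℕ)) (-(n - 1)) *
      yz R 1 0 ^ ((i : ℕ) - s) * yz R 0 (-1) * yz R 1 0) := by
    rw [yz_pow, yz_mul, yz_mul, yz_mul, yz_mul]
    congr 1
    · omega
    · ring
  rw [h1, h2, zpow_add_one] at h
  simp only [Units.val_mul, map_mul, map_pow, Units.val_neg, Units.val_one] at h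
  rw [x_sub_C_mul, baseB, map_mul, yv_eq_subst_yz, inv_onePlusX_eq]
  linear_combination -subst i (factor P) * h

theorem sign_eq_one (m n : ℕ) {G : Type*} [CommGroup G] [HasDistribNeg G] :
    (-1 : G) ^ (((m : ℤ) - 1) * n + ((n + 1).choose 2 : ℕ)) *
      ∏ i : Fin n, (-1 : G) ^ ((i : ℤ) - m) = 1 := by
  have hprod : ∀ n : ℕ, ∏ i : Fin n, (-1 : G) ^ (((i : ℕ) : ℤ) - m) =
      (-1 : G) ^ ((n.choose 2 : ℕ) - (m : ℤ) * n) := by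
    intro n
    induction n with
    | zero => simp
    | succ n ih =>
      rw [Fin.prod_univ_castSucc]
      simp only [Fin.val_castSucc, Fin.val_last]
      rw [ih, ← zpow_add, Nat.choose_succ_succ' n 1, Nat.choose_one_right]
      congr 1
      push_cast
      ring
  rw [hprod, ← zpow_add]
  refine Even.neg_one_zpow ?_
  rw [Nat.choose_succ_succ' n 1, Nat.choose_one_right]
  exact ⟨(n.choose 2 : ℕ), by push_cast; ring⟩

theorem regroup {A : Type*} [CommRing A]
    {ε c p p' X X' v D e e' b b' r r' d o y : A} (h : p * X = e * (b * r))
    (h' : p' * X' = e' * (b' * (r' * d * o * y))) (hε : ε * (e * e') = 1) :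
    ε * c * p * p' * (X * X' * v) * D =
      b * b' * v * (r * r' * (d * (o * D) * (c * y))) := by
  linear_combination (ε * c * v * D * p' * X') * h + (ε * c * v * D * e * b * r) * h' +
    (c * v * D * b * r * b' * r' * d * o * y) * hε

theorem expression_eq (m k : ℕ) (hk : 1 ≤ k) (hkn : k ≤ n) (P Q : R) :
    expression m n k hk hkn P Q =
      (∏ i, subst i (baseB m P)) * alternant n (baseV R) * (rowFactor n k Q *
        (mon R (n - k) (fun j : Fin n => (j : ℕ) - (n - k)) * symSeries n R (n - k) *
          (Q • pivot R (show n - k < n by omega) + mon R (n - k) (fun _ : Fin n => 1)))) := by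
  have hlow : (Finset.univ.filter fun i : Fin n => idx i ≤ (n : ℤ) - k) = low n (n - k) := by
    ext i
    rw [Finset.mem_filter, low, Finset.mem_filter]
    simp only [Finset.mem_univ, true_and, idx]
    omega
  have hblk : (Finset.univ.filter fun i : Fin n => (n : ℤ) - k + 1 ≤ idx i) = blk n (n - k) := by
    ext i
    rw [Finset.mem_filter, mem_blk]
    simp only [Finset.mem_univ, true_and, idx]
    omega
  have hA := Finset.prod_congr (rfl : low n (n - k) = low n (n - k))
    fun i _ => low_factor m k i P Q
  have hB := Finset.prod_congr (rfl : blk n (n - k) = blk n (n - k))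
    fun i hi => blk_factor m (n - k) i (mem_blk.1 hi) P
  have hX := prod_low_mul_prod_blk (n - k)
    fun i : Fin n => ((x R i ^ (2 * ((n - 1 : ℕ) : ℤ)) : (Laurent n R)ˣ) : Laurent n R)
  have hb := prod_low_mul_prod_blk (n - k) fun i : Fin n => subst i (baseB m P)
  have hsign := congrArg (fun u : (Laurent n R)ˣ => (u : Laurent n R))
    (sign_eq_one m n (G := (Laurent n R)ˣ))
  simp only [Units.val_mul, Units.coe_prod, Units.val_one] at hsign
  rw [← prod_low_mul_prod_blk (n - k)] at hsign
  rw [expression, hlow, hblk, prod_sub_eq_alternant, ← hX, ← hb, ← correction_mul k hk hkn,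
    rowFactor, symSeries]
  rw [Finset.prod_mul_distrib, Finset.prod_mul_distrib (s := low n (n - k))
    (f := fun i => (((-1 : (Laurent n R)ˣ) ^ ((i : ℤ) - m) : (Laurent n R)ˣ) : Laurent n R)),
    Finset.prod_mul_distrib (s := low n (n - k)) (f := fun i => subst i (baseB m P))] at hA
  rw [Finset.prod_mul_distrib, Finset.prod_mul_distrib (s := blk n (n - k))
    (f := fun i => (((-1 : (Laurent n R)ˣ) ^ ((i : ℤ) - m) : (Laurent n R)ˣ) : Laurent n R)),
    Finset.prod_mul_distrib (s := blk n (n - k)) (f := fun i => subst i (baseB m P)),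
    Finset.prod_mul_distrib (s := blk n (n - k)) (g := fun i => yv R i ^ 1),
    Finset.prod_mul_distrib (s := blk n (n - k))
      (g := fun i => (((onePlusX R i)⁻¹ : (Laurent n R)ˣ) : Laurent n R)),
    Finset.prod_mul_distrib (s := blk n (n - k)) (g := fun i => yv R i ^ ((i : ℕ) - (n - k)))] at hB
  exact regroup hA hB hsign

theorem vanishGE_mulFun (s : ℕ) (g f : Laurent n R) {N : ℤ} (hN : ∀ i, OrdGE i N (g * f)) {M : ℕ}
    (hM : 0 < N + M) : VanishGE s M (mulFun (mulFun (constTermLin n R) g) f) := by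
  intro i _ h hh
  rw [mulFun_apply, mulFun_apply, ← mul_assoc]
  exact ((hN i).mul hh).constTerm_eq_zero hM

theorem symOn_rowFactor (k : ℕ) (Q : R) : SymOn (n - k) (rowFactor n k Q) := by
  refine SymOn.mul ?_ (symOn_prod_subst _)
  intro i j hi hj hij
  rw [map_prod]
  refine Finset.prod_congr rfl fun l hl => ?_
  exact symOn_subst (Finset.mem_filter.1 hl).2 _ i j hi hj hij

/-- In the block with `s = n - k`, the exponent `h_i + 1 + i` is split as `(1 + s) + (i - s) + h_i`.
The first part is independent of the row, so it keeps `rowFactor` symmetric in the block. -/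
theorem altForm_row_eq (b v : HahnSeries ℤ R) (k : ℕ) (Q : R) (h : Fin n → ℕ) :
    altForm n b v (fun i : Fin n =>
        if (i : ℕ) < n - k then yz R (i + 1) (-(i + k)) * factor Q
        else yz R (h i + 1 + i) (-(n - 1))) =
      mulFun (altFun n b v) (rowFactor n k Q)
        (mon R (n - k) (fun j : Fin n => (j : ℕ) - (n - k)) * mon R (n - k) h) := by
  rw [altForm_apply, mulFun_apply, ← prod_low_mul_prod_blk (n - k), rowFactor, mul_assoc]
  congr 2
  · refine Finset.prod_congr rfl fun i hi => ?_
    rw [if_pos (Finset.mem_filter.1 hi).2]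
  · rw [mon, mon, ← Finset.prod_mul_distrib, ← Finset.prod_mul_distrib]
    refine Finset.prod_congr rfl fun i hi => ?_
    have hi' := mem_blk.1 hi
    rw [if_neg (by omega), yv_eq_subst_yz, ← map_pow, ← map_pow, ← map_mul, ← map_mul, yz_pow,
      yz_pow, yz_mul, yz_mul]
    congr 2
    · omega
    · ring

end Magog

theorem mainTheorem8 {R : Type*} [CommRing R] (m n k : ℕ) (hk : 1 ≤ k) (hkn : k ≤ n) (P Q : R) :
    Magog.genFun m n k P Q = Magog.constTerm (Magog.expression m n k hk hkn P Q) := by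
  have hs : n - k < n := by omega
  obtain ⟨N, hN⟩ := Magog.exists_ordGE (((∏ i, Magog.subst i (Magog.baseB m P)) *
    Magog.alternant n (Magog.baseV R)) * Magog.rowFactor n k Q)
  -- The height bound must be at least `m + n` to contain all trapezoids, and large enough that `N +
  -- M > 0`, so that the functional kills everything of order `M`. The final `+ 1` gives the
  -- successor form required by `sum_heights_weighted`.
  have hvan := Magog.vanishGE_mulFun (n - k) _ _ hN (M := m + n + (1 - N).toNat + 1) (by omega)
  have halt := ((Magog.altOn_altFun (n := n) (Magog.baseB m P) (Magog.baseV R)).mono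
    (Nat.zero_le (n - k))).mul_symOn (Magog.symOn_rowFactor k Q)
  rw [Magog.genFun_eq_sum_heights m (m + n + (1 - N).toNat + 1) (by omega) hk hkn,
    Finset.sum_congr rfl fun h _ => by rw [Magog.altForm_row_eq],
    Magog.sum_heights_weighted hs _ halt hvan, Magog.expression_eq]
  rfl
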